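/- **Proposition (Complete positivity from Wightman positivity).** Work in Minkowski space $M=\mathbb R^4$ with signature $(+,-,-,-)$. Let $C:M\to\mathbb R$ be a smooth clock field with timelike gradient, $\Sigma=\{C=\tau\}$ a level set, $x\in\Sigma$, and $n=n(x)=\partial C/\sqrt{\partial C\cdot\partial C}$ its unit timelike normal at $x$. Let $(G^+_{\alpha\beta})_{\alpha,\beta\in I}$, $I$ finite, be a matrix of tempered two-point distributions of the environment such that * (Wightman positivity) $\sum_{\alpha,\beta}\iint \overline{f_\alpha(y)}\,G^+_{\alpha\beta}(y,z)\,f_\beta(z)\,d^4y\,d^4z\ge 0$ for all Schwartz functions $f_\alpha$; * (stationarity along $n$) $G^+_{\alpha\beta}(y+sn,z+sn)=G^+_{\alpha\beta}(y,z)$ for all $s\in\mathbb R$; * the restriction $g_{\alpha\beta}(s)=G^+_{\alpha\beta}(x,x-sn)$ exists as a tempered distribution in $s$: for every nonnegative $\varphi\in C_c^\infty(M)$ with $\int\varphi=1$, with $\varphi_{\varepsilon,z}(y)=\varepsilon^{-4}\varphi((y-z)/\varepsilon)$, the functions $s\mapsto G^+_{\alpha\beta}(\varphi_{\varepsilon,x},\varphi_{\varepsilon,x-sn})$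 converge to $g_{\alpha\beta}$ in $\mathcal S'(\mathbb R)$ (tested against each Schwartz function) as $\varepsilon\downarrow0$. A matrix $(g_{\alpha\beta})$ of tempered distributions on $\mathbb R$ is *of positive type* if $\sum_{\alpha,\beta}\iint\overline{\psi_\alpha(s)}\,\psi_\beta(t)\,g_{\alpha\beta}(t-s)\,ds\,dt\ge0$ for all Schwartz functions $\psi_\alpha$; a function $w:\mathbb R\to\mathbb R$ is of positive type if all matrices $(w(s_j-s_i))_{ij}$ are positive semidefinite. 1. The matrix $(g_{\alpha\beta})$ is of positive type. Let moreover $w:\mathbb R\to\mathbb R$ (the clock-resolution kernel $w_\sigma$) be of positive type and smooth with all derivatives polynomially bounded, let $F_\alpha:M\to\mathbb C$ be coupling functions, and put $C_{\alpha\beta}(x;s)=F_\alpha(x)\overline{F_\beta(x)}\,w(s)\,g_{\alpha\beta}(s)$ and $\kappa_{\alpha\beta}(\omega)=\int_{-\infty}^{\infty}e^{-i\omega s}\,C_{\alpha\beta}(x;s)\,ds$, the Fourier transform of a tempered distribution. 2. The products $w\,g_{\alpha\beta}$, and the smeared correlators $C_{\alpha\beta}(x;\cdot)$, are again of positive type.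 3. $\kappa$ is a positive semidefinite matrix-valued distribution: for every Schwartz function $h\ge0$ the matrix $(\kappa_{\alpha\beta}(h))_{\alpha\beta}$ is positive semidefinite. If $w$ is a Schwartz function, then $\kappa$ is given by the continuous functions $\kappa_{\alpha\beta}(\omega)=F_\alpha(x)\overline{F_\beta(x)}\,\langle g_{\alpha\beta},\,e^{-i\omega\,\cdot}\,w\rangle$. Whenever $\kappa$ is given by continuous functions $\kappa_{\alpha\beta}(\omega)$, the matrix $(\kappa_{\alpha\beta}(\omega))_{\alpha\beta}$ is positive semidefinite for every $\omega\in\mathbb R$. 4. Suppose that $\kappa$ is given by continuous functions. Let $\mathcal H_S(\cdot)$, $\mathcal H_{\rm LS}[\cdot\,;\cdot]$ be bounded self-adjoint operators (system Hamiltonian density and Lamb shift) and $A_{\alpha,\omega}(\cdot)$ arbitrary bounded operators on a complex Hilbert space $\mathcal H$, and let $S\subset\mathbb R$ be a set of frequencies with $\sum_{\omega\in S}|\kappa_{\alpha\beta}(\omega)|\,\|A_{\alpha,\omega}(x)\|\,\|A_{\beta,\omega}(x)\|<\infty$ for all $\alpha,\beta$. Then the local generator $$L\rho=-i\big[\mathcal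 H_S(x)+\mathcal H_{\rm LS}[\Sigma;x],\rho\big]+\sum_{\alpha,\beta}\sum_{\omega\in S}\kappa_{\alpha\beta}(\omega)\Big(A_{\alpha,\omega}(x)\,\rho\,A_{\beta,\omega}(x)^\dagger-\tfrac12\big\{A_{\beta,\omega}(x)^\dagger A_{\alpha,\omega}(x),\rho\big\}\Big)$$ is completely positive and trace preserving on $\Sigma$ at $x$: for every $t\ge0$ the map $e^{tL}$ on the bounded operators of $\mathcal H$ is completely positive, and it maps trace-class operators to trace-class operators with the same trace. -/

import Mathlib

open MeasureTheory Filter Topology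
open scoped SchwartzMap FourierTransform ComplexOrder ComplexConjugate InnerProductSpace
open scoped CStarAlgebra

noncomputable section

/-! ### Minkowski space, clock fields and their hypersurfaces -/

/-- Spacetime points and vectors in inertial coordinates, index `0` being the time coordinate.  The
Euclidean norm of this type enters only through the Schwartz space; the geometry is
`minkowskiForm`. -/
abbrev Spacetime : Type := EuclideanSpace ℝ (Fin 4)

/-- The diagonal entries of the metric of signature `(+,-,-,-)`. -/
def minkowskiSign (μ : Fin 4) : ℝ := if μ = 0 then 1 else -1

/-- The Minkowski form `u · v = u⁰v⁰ - u¹v¹ - u²v² - u³v³`. -/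
def minkowskiForm (u v : Spacetime) : ℝ := ∑ μ, minkowskiSign μ * u μ * v μ

/-- The gradient vector `∂^μ C = η^{μν} ∂_ν C` of a clock field. -/
def clockGradient (C : Spacetime → ℝ) (x : Spacetime) : Spacetime :=
  WithLp.toLp 2 fun μ => minkowskiSign μ * fderiv ℝ C x (EuclideanSpace.single μ 1)

/-- The unit normal `n^μ = ∂^μ C / √(∂C · ∂C)`. -/
def clockNormal (C : Spacetime → ℝ) (x : Spacetime) : Spacetime :=
  (Real.sqrt (minkowskiForm (clockGradient C x) (clockGradient C x)))⁻¹ • clockGradient C x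

/-- The level set `Σ_τ = {x : C x = τ}`. -/
def clockHypersurface (C : Spacetime → ℝ) (τ : ℝ) : Set Spacetime := {x | C x = τ}

/-- `C` is a smooth clock field with timelike gradient. -/
structure IsClockField (C : Spacetime → ℝ) : Prop where
  smooth : ContDiff ℝ (⊤ : ℕ∞) C
  timelike : ∀ x, 0 < minkowskiForm (clockGradient C x) (clockGradient C x)

/-! ### Two-point distributions of the environment -/

/-- Complex conjugation of Schwartz functions. -/
def schwartzConj {E : Type*} [NormedAddCommGroup E] [NormedSpace ℝ E] (f : 𝓢(E, ℂ)) : 𝓢(E, ℂ) :=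
  f.postcompCLM (𝕜 := ℝ) (Complex.conjCLE : ℂ →L[ℝ] ℂ)

theorem schwartzConj_apply {E : Type*} [NormedAddCommGroup E] [NormedSpace ℝ E] (f : 𝓢(E, ℂ))
    (y : E) : schwartzConj f y = conj (f y) := rfl

/-- A matrix `G⁺_{αβ}(x, y)` of tempered two-point distributions, as separately continuous bilinear
functionals `(f, g) ↦ ∬ f(x) g(y) G⁺_{αβ}(x, y)` on Schwartz functions. -/
abbrev TwoPointMatrix (ι : Type*) : Type _ := ι → ι → (𝓢(Spacetime, ℂ) →L[ℂ] 𝓢'(Spacetime, ℂ))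

/-- Wightman positivity: `∑_{αβ} ∬ conj (f_α(x)) G⁺_{αβ}(x, y) f_β(y) ≥ 0`, i.e. the norm of
`∑_β X_β(f_β) Ω` is nonnegative. -/
def WightmanPositive {ι : Type*} [Fintype ι] (G : TwoPointMatrix ι) : Prop :=
  ∀ f : ι → 𝓢(Spacetime, ℂ), 0 ≤ ∑ α, ∑ β, G α β (schwartzConj (f α)) (f β)

/-- Invariance of the two-point distributions under the translations along the vector `n`:
`G⁺(x + s n, y + s n) = G⁺(x, y)` for all real `s`. -/
def StationaryAlong {ι : Type*} (G : TwoPointMatrix ι) (n : Spacetime) : Prop :=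
  ∀ (α β : ι) (s : ℝ) (f g : 𝓢(Spacetime, ℂ)),
    G α β (f.compSubConstCLM ℂ (s • n)) (g.compSubConstCLM ℂ (s • n)) = G α β f g

/-- The approximate delta function `φ_{ε,z}(y) = ε⁻⁴ φ((y - z)/ε)` at `z` (and `0` if `ε = 0`). -/
def mollifier (φ : 𝓢(Spacetime, ℂ)) (ε : ℝ) (z : Spacetime) : 𝓢(Spacetime, ℂ) :=
  if h : ε = 0 then 0 else
    (((ε ^ 4)⁻¹ : ℝ) : ℂ) •
      (φ.compCLMOfContinuousLinearEquiv ℂ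
        (ContinuousLinearEquiv.smulLeft (R₁ := ℝ) (M₁ := Spacetime)
          (Units.mk0 ε⁻¹ (inv_ne_zero h)))).compSubConstCLM ℂ z

theorem mollifier_apply (φ : 𝓢(Spacetime, ℂ)) {ε : ℝ} (hε : ε ≠ 0) (z y : Spacetime) :
    mollifier φ ε z y = (((ε ^ 4)⁻¹ : ℝ) : ℂ) * φ (ε⁻¹ • (y - z)) := by
  simp [mollifier, hε, Units.smul_def]

/-- `g_{αβ}` is the restriction `s ↦ G⁺_{αβ}(x, x - s n)` of the two-point distributions to the
displacements along `n` from `x`: smearing both points with the same nonnegative approximate delta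
function and letting it shrink gives `g_{αβ}` in the sense of distributions in `s`. -/
def IsRestrictionAlong {ι : Type*} (G : TwoPointMatrix ι) (x n : Spacetime)
    (g : ι → ι → 𝓢'(ℝ, ℂ)) : Prop :=
  ∀ φ : 𝓢(Spacetime, ℂ), HasCompactSupport φ → (∀ y, 0 ≤ φ y) → ∫ y, φ y = 1 →
    ∀ (α β : ι) (ψ : 𝓢(ℝ, ℂ)),
      Tendsto (fun ε : ℝ =>
          ∫ s : ℝ, ψ s * G α β (mollifier φ ε x) (mollifier φ ε (x - s • n)))
        (𝓝[>] 0) (𝓝 (g α β ψ))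

/-! ### Positive type -/

/-- The Schwartz function `u ↦ ∫ conj (ψ s) φ(s + u) ds`; see `correlation_apply`. -/
def correlation (ψ φ : 𝓢(ℝ, ℂ)) : 𝓢(ℝ, ℂ) :=
  𝓕⁻ (SchwartzMap.smulLeftCLM ℂ (fun ξ => conj ((𝓕 ψ) ξ)) (𝓕 φ))

theorem correlation_apply (ψ φ : 𝓢(ℝ, ℂ)) (u : ℝ) :
    correlation ψ φ u = ∫ s, conj (ψ s) * φ (s + u) := by
  have hT : Function.HasTemperateGrowth (fun ξ => conj ((𝓕 ψ) ξ)) :=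
    (schwartzConj (𝓕 ψ)).hasTemperateGrowth
  have hsh : ∀ ξ, 𝓕 (φ.compSubConstCLM ℂ (-u)) ξ =
      Complex.exp (2 * Real.pi * u * ξ * Complex.I) * (𝓕 φ) ξ := by
    intro ξ
    rw [SchwartzMap.fourier_coe, SchwartzMap.fourier_coe, Real.fourier_real_eq,
      Real.fourier_real_eq, ← integral_const_mul,
      ← integral_sub_right_eq_self (fun v => Complex.exp (2 * Real.pi * u * ξ * Complex.I) *
        Real.fourierChar (-(v * ξ)) • φ v) (-u)]
    congr 1
    ext v
    simp only [SchwartzMap.compSubConstCLM_apply, Circle.smul_def, Real.fourierChar_apply,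
      smul_eq_mul]
    rw [← mul_assoc, ← Complex.exp_add]
    congr 2
    push_cast
    ring
  have hP := SchwartzMap.integral_sesq_fourier_fourier ψ (φ.compSubConstCLM ℂ (-u))
    (innerSL ℂ : ℂ →L⋆[ℂ] ℂ →L[ℂ] ℂ)
  simp only [innerSL_apply_apply, RCLike.inner_apply, hsh] at hP
  rw [correlation, SchwartzMap.fourierInv_coe, Real.fourierInv_eq']
  simp only [SchwartzMap.smulLeftCLM_apply_apply hT]
  calc _ = ∫ ξ : ℝ, Complex.exp (2 * Real.pi * u * ξ * Complex.I) * (𝓕 φ) ξ *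
        (starRingEnd ℂ) ((𝓕 ψ) ξ) := by
        congr 1
        ext ξ
        simp only [RCLike.inner_apply, conj_trivial, smul_eq_mul]
        push_cast
        ring_nf
    _ = _ := by
        rw [hP]
        congr 1
        ext s
        simp [mul_comm]

/-- A matrix of tempered distributions on the line is of positive type (Bochner–Schwartz) if
`∑_{αβ} ∬ conj (ψ_α(s)) ψ_β(t) g_{αβ}(t - s) ds dt ≥ 0` for all Schwartz functions `ψ_α`. -/
def IsPositiveType {ι : Type*} [Fintype ι] (g : ι → ι → 𝓢'(ℝ, ℂ)) : Prop :=
  ∀ ψ : ι → 𝓢(ℝ, ℂ), 0 ≤ ∑ α, ∑ β, g α β (correlation (ψ α) (ψ β))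

/-- A real function on the line is of positive type (Bochner) if all the matrices
`(w (s_j - s_i))_{ij}` are positive semidefinite.  Such a function is automatically even. -/
def IsPositiveTypeFun (w : ℝ → ℝ) : Prop :=
  ∀ (m : ℕ) (s : Fin m → ℝ), (Matrix.of fun i j => ((w (s j - s i) : ℝ) : ℂ)).PosSemidef

/-! ### The second-order coefficients -/

/-- The product `w g_{αβ}` of a kernel of temperate growth with tempered distributions. -/
def kernelMul {ι : Type*} (w : ℝ → ℝ) (g : ι → ι → 𝓢'(ℝ, ℂ)) : ι → ι → 𝓢'(ℝ, ℂ) :=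
  fun α β => TemperedDistribution.smulLeftCLM ℂ (fun s => (w s : ℂ)) (g α β)

/-- The smeared correlator `C_{αβ}(s) = F_α conj(F_β) w(s) g_{αβ}(s)`. -/
def smearedCorrelator {ι : Type*} (F : ι → ℂ) (w : ℝ → ℝ) (g : ι → ι → 𝓢'(ℝ, ℂ)) :
    ι → ι → 𝓢'(ℝ, ℂ) :=
  fun α β => (F α * conj (F β)) • kernelMul w g α β

/-- The Fourier transform with angular frequencies, `h ↦ (s ↦ ∫ e^{-iωs} h(ω) dω)`; see
`angularFourier_apply`. -/
def angularFourier : 𝓢(ℝ, ℂ) →L[ℂ] 𝓢(ℝ, ℂ) :=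
  (SchwartzMap.compCLMOfContinuousLinearEquiv ℂ
    (ContinuousLinearEquiv.smulLeft (R₁ := ℝ) (M₁ := ℝ)
      (Units.mk0 (2 * Real.pi)⁻¹ (inv_ne_zero Real.two_pi_pos.ne')))).comp
    (FourierTransform.fourierCLM ℂ 𝓢(ℝ, ℂ))

theorem angularFourier_apply (h : 𝓢(ℝ, ℂ)) (s : ℝ) :
    angularFourier h s = ∫ ω : ℝ, Complex.exp (-(Complex.I * ω * s)) * h ω := by
  have h0 : angularFourier h s = (𝓕 h) ((2 * Real.pi)⁻¹ * s) := by
    rfl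
  rw [h0, SchwartzMap.fourier_coe, Real.fourier_real_eq]
  congr 1
  ext ω
  simp only [Circle.smul_def, Real.fourierChar_apply, smul_eq_mul]
  congr 2
  have : (Real.pi : ℂ) ≠ 0 := by exact_mod_cast Real.pi_ne_zero
  push_cast
  field_simp

/-- The coefficients `κ_{αβ}(ω) = ∫ e^{-iωs} C_{αβ}(s) ds` as tempered distributions in `ω`. -/
def kossakowskiDistribution {ι : Type*} (C : ι → ι → 𝓢'(ℝ, ℂ)) : ι → ι → 𝓢'(ℝ, ℂ) :=
  fun α β => PointwiseConvergenceCLM.precomp ℂ angularFourier (C α β)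

theorem kossakowskiDistribution_apply {ι : Type*} (C : ι → ι → 𝓢'(ℝ, ℂ)) (α β : ι)
    (h : 𝓢(ℝ, ℂ)) : kossakowskiDistribution C α β h = C α β (angularFourier h) := rfl

/-- The distributions `κ_{αβ}` are given by the continuous functions `k_{αβ}(ω)`. -/
def IsContinuousDensity {ι : Type*} (κ : ι → ι → 𝓢'(ℝ, ℂ)) (k : ℝ → Matrix ι ι ℂ) : Prop :=
  ∀ α β, Continuous (fun ω => k ω α β) ∧
    ∀ h : 𝓢(ℝ, ℂ), HasCompactSupport h → κ α β h = ∫ ω : ℝ, k ω α β * h ω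

/-- For a rapidly decreasing kernel `w`, the value at `ω` of
`∫ e^{-iωs} F_α conj(F_β) w(s) g_{αβ}(s) ds`, the integral being the pairing of `g_{αβ}` with the
Schwartz function `s ↦ e^{-iωs} w(s)`. -/
def kossakowskiMatrix {ι : Type*} (F : ι → ℂ) (w : 𝓢(ℝ, ℂ)) (g : ι → ι → 𝓢'(ℝ, ℂ)) (ω : ℝ) :
    Matrix ι ι ℂ :=
  Matrix.of fun α β => F α * conj (F β) *
    g α β (SchwartzMap.smulLeftCLM ℂ (fun s : ℝ => Complex.exp (-(Complex.I * ω * s))) w)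

/-! ### Generators in Gorini–Kossakowski–Lindblad–Sudarshan form -/

section GKLS

variable {H : Type*} [NormedAddCommGroup H] [InnerProductSpace ℂ H] [CompleteSpace H]

/-- `ρ ↦ A ρ B† - ½ {B† A, ρ}`. -/
def gklsTerm (A B : H →L[ℂ] H) : (H →L[ℂ] H) →L[ℂ] (H →L[ℂ] H) :=
  ContinuousLinearMap.mulLeftRight ℂ (H →L[ℂ] H) A (star B) -
    (1 / 2 : ℂ) • (ContinuousLinearMap.mulLeftRight ℂ (H →L[ℂ] H) (star B * A) 1 +
      ContinuousLinearMap.mulLeftRight ℂ (H →L[ℂ] H) 1 (star B * A))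

theorem gklsTerm_apply (A B ρ : H →L[ℂ] H) :
    gklsTerm A B ρ = A * ρ * star B - (1 / 2 : ℂ) • (star B * A * ρ + ρ * (star B * A)) := by
  simp [gklsTerm]

/-- `ρ ↦ -i [K, ρ]`. -/
def hamiltonianTerm (K : H →L[ℂ] H) : (H →L[ℂ] H) →L[ℂ] (H →L[ℂ] H) :=
  (-Complex.I) • (ContinuousLinearMap.mulLeftRight ℂ (H →L[ℂ] H) K 1 -
    ContinuousLinearMap.mulLeftRight ℂ (H →L[ℂ] H) 1 K)

theorem hamiltonianTerm_apply (K ρ : H →L[ℂ] H) :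
    hamiltonianTerm K ρ = -(Complex.I • (K * ρ - ρ * K)) := by
  simp [hamiltonianTerm]

/-- The generator
`ρ ↦ -i [K, ρ] + ∑_{α,β} ∑_{ω ∈ S} k_{αβ}(ω) (A_{αω} ρ A_{βω}† - ½ {A_{βω}† A_{αω}, ρ})`. -/
def gklsGenerator {ι : Type*} [Fintype ι] (K : H →L[ℂ] H) (S : Set ℝ) (k : ℝ → Matrix ι ι ℂ)
    (A : ι → ℝ → (H →L[ℂ] H)) : (H →L[ℂ] H) →L[ℂ] (H →L[ℂ] H) :=
  hamiltonianTerm K + ∑ α, ∑ β, ∑' ω : S, k ω α β • gklsTerm (A α ω) (A β ω)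

/-- The trace class: the span of the positive operators `P` with `∑ ⟨b_i, P b_i⟩ < ∞`. -/
def IsTraceClass {J : Type*} (b : HilbertBasis J ℂ H) (T : H →L[ℂ] H) : Prop :=
  T ∈ Submodule.span ℂ {P : H →L[ℂ] H | 0 ≤ P ∧ Summable fun i => ⟪b i, P (b i)⟫_ℂ}

/-- The trace `∑ ⟨b_i, T b_i⟩`, an absolutely convergent sum on the trace class. -/
def opTrace {J : Type*} (b : HilbertBasis J ℂ H) (T : H →L[ℂ] H) : ℂ := ∑' i, ⟪b i, T (b i)⟫_ℂ

/-- Complete positivity of a map on bounded operators. -/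
def IsCompletelyPositive (Λ : (H →L[ℂ] H) →L[ℂ] (H →L[ℂ] H)) : Prop :=
  ∃ Φ : (H →L[ℂ] H) →CP (H →L[ℂ] H), ∀ T, Φ T = Λ T

/-- `Λ` maps trace-class operators to trace-class operators with the same trace, the trace being
computed in any orthonormal basis. -/
def IsTracePreserving (Λ : (H →L[ℂ] H) →L[ℂ] (H →L[ℂ] H)) : Prop :=
  ∀ (s : Set H) (b : HilbertBasis s ℂ H) (T : H →L[ℂ] H), IsTraceClass b T →
    IsTraceClass b (Λ T) ∧ opTrace b (Λ T) = opTrace b T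

/-- The generator `L` is completely positive and trace preserving in the sense that all the maps
`exp (t L)`, `t ≥ 0`, that it generates are. -/
def IsCPTPGenerator (L : (H →L[ℂ] H) →L[ℂ] (H →L[ℂ] H)) : Prop :=
  ∀ t : ℝ, 0 ≤ t →
    IsCompletelyPositive (NormedSpace.exp ((t : ℂ) • L)) ∧
      IsTracePreserving (NormedSpace.exp ((t : ℂ) • L))

end GKLS

end

/-! Smearing both points turns the restriction into honest functions `k_ε(u) = G(φ_{ε,x},
φ_{ε,x-un})`. Wightman positivity, tested on finite combinations of mollifiers centred at `x - s_i
n`, together with stationarity along `n`, says that `k_ε` is a continuous matrix-valued function of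
positive type. Hence `g` is a distributional limit of such functions (`IsPosDefLimit`,
`isPosDefLimit_of_isRestrictionAlong`), and this property, rather than positive type of `g` itself,
is carried through the argument. It survives multiplication by `w` (Schur product,
`IsPosDefMatrixFun.mul`) and by `F_α conj(F_β)`.

Both positivity statements about distributions are then limits of statements about continuous
functions. Finite double sums become double integrals by averaging over independent random points
(`integral_prod_nonneg_of_sum_nonneg`), which gives positive type. For `h ≥ 0` the transform of `h`
is of positive type, so `κ(h)` tested on a vector is a limit of integrals of integrable functions of
positive type, and these integrals are nonnegative. Bump functions shrinking to `ω` give pointwise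
positivity of a continuous density.

With `k(ω) ≥ 0` the generator is a completely positive jump part plus a drift `ρ ↦ Vρ + ρV†`. Up to
a multiple of the identity and an error of order `1/r`, the drift is `r⁻¹ (r + V) ρ (r + V)†`, so
the exponential is a limit of completely positive maps (`MatrixPositive.exp_add_driftMap`). The
generator is also a difference of two positive maps bounded for the trace. The exponential series
can therefore be traced term by term, and every term but the zeroth has trace zero
(`isTraceClass_exp_apply`). -/

noncomputable section

/-! ### Maps positive on all matrix amplifications -/

section CompletePositivity

variable {H : Type*} [NormedAddCommGroup H] [InnerProductSpace ℂ H] [CompleteSpace H]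

/-- The map `ρ ↦ V ρ V†`. -/
def conjMap (V : H →L[ℂ] H) : (H →L[ℂ] H) →L[ℂ] (H →L[ℂ] H) :=
  ContinuousLinearMap.mulLeftRight ℂ (H →L[ℂ] H) V (star V)

theorem conjMap_apply (V ρ : H →L[ℂ] H) : conjMap V ρ = V * ρ * star V := by
  simp [conjMap]

/-- The entrywise action on matrices over the bounded operators preserves positivity. -/
def MatrixPositive (Λ : (H →L[ℂ] H) →L[ℂ] (H →L[ℂ] H)) : Prop :=
  ∀ (k : ℕ) (M : CStarMatrix (Fin k) (Fin k) (H →L[ℂ] H)), 0 ≤ M → 0 ≤ M.map Λ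

namespace MatrixPositive

variable {Λ Λ' : (H →L[ℂ] H) →L[ℂ] (H →L[ℂ] H)}

theorem isCompletelyPositive (h : MatrixPositive Λ) : IsCompletelyPositive Λ :=
  ⟨{ toLinearMap := Λ.toLinearMap, map_cstarMatrix_nonneg' := h }, fun _ => rfl⟩

theorem nonneg (h : MatrixPositive Λ) {P : H →L[ℂ] H} (hP : 0 ≤ P) : 0 ≤ Λ P := by
  obtain ⟨Φ, hΦ⟩ := h.isCompletelyPositive
  rw [← hΦ]
  exact map_nonneg Φ hP

protected theorem zero : MatrixPositive (0 : (H →L[ℂ] H) →L[ℂ] (H →L[ℂ] H)) := by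
  intro k M _
  have : M.map (0 : (H →L[ℂ] H) →L[ℂ] (H →L[ℂ] H)) = 0 := by
    ext i j : 2
    rfl
  exact this.ge

protected theorem one : MatrixPositive (1 : (H →L[ℂ] H) →L[ℂ] (H →L[ℂ] H)) := by
  intro k M hM
  exact hM

protected theorem add (h : MatrixPositive Λ) (h' : MatrixPositive Λ') :
    MatrixPositive (Λ + Λ') := by
  intro k M hM
  have : M.map (Λ + Λ') = M.map Λ + M.map Λ' := by
    ext i j : 2
    rfl
  rw [this]
  exact add_nonneg (h k M hM) (h' k M hM)

protected theorem sum {J : Type*} {s : Finset J} {Φ : J → (H →L[ℂ] H) →L[ℂ] (H →L[ℂ] H)}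
    (h : ∀ j ∈ s, MatrixPositive (Φ j)) : MatrixPositive (∑ j ∈ s, Φ j) :=
  Finset.sum_induction _ _ (fun _ _ => MatrixPositive.add) .zero h

protected theorem comp (h : MatrixPositive Λ) (h' : MatrixPositive Λ') :
    MatrixPositive (Λ * Λ') := by
  intro k M hM
  exact h k _ (h' k M hM)

protected theorem pow (h : MatrixPositive Λ) (n : ℕ) : MatrixPositive (Λ ^ n) := by
  induction n with
  | zero => exact pow_zero Λ ▸ .one
  | succ n ih => exact pow_succ Λ n ▸ ih.comp h

protected theorem smul (h : MatrixPositive Λ) {c : ℝ} (hc : 0 ≤ c) :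
    MatrixPositive ((c : ℂ) • Λ) := by
  intro k M hM
  have : M.map ((c : ℂ) • Λ) = (c : ℂ) • M.map Λ := by
    ext i j : 2
    rfl
  rw [this]
  exact smul_nonneg (by exact_mod_cast hc) (h k M hM)

/-- Each condition only evaluates the map at the entries of a fixed matrix, and the positive cone is
closed. Limits and series of completely positive maps rest on this. -/
theorem isClosed : IsClosed {Λ : (H →L[ℂ] H) →L[ℂ] (H →L[ℂ] H) | MatrixPositive Λ} := by
  simp only [MatrixPositive, Set.ofPred_forall]
  refine isClosed_iInter fun k => isClosed_iInter fun M => isClosed_iInter fun _ => ?_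
  refine isClosed_le continuous_const ?_
  exact continuous_pi fun i => continuous_pi fun j =>
    (ContinuousLinearMap.apply ℂ (H →L[ℂ] H) (M i j)).continuous

protected theorem hasSum {J : Type*} {Φ : J → (H →L[ℂ] H) →L[ℂ] (H →L[ℂ] H)}
    (hs : HasSum Φ Λ) (h : ∀ j, MatrixPositive (Φ j)) : MatrixPositive Λ :=
  isClosed.mem_of_tendsto hs (Eventually.of_forall fun _ => .sum fun j _ => h j)

protected theorem exp (h : MatrixPositive Λ) : MatrixPositive (NormedSpace.exp Λ) := by
  have hs := NormedSpace.exp_series_hasSum_exp' (𝕂 := ℂ) Λ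
  refine .hasSum hs fun n => ?_
  have := (h.pow n).smul (c := (n.factorial : ℝ)⁻¹) (by positivity)
  simpa using this

/-- The amplification is `M ↦ D M D†` with `D` the diagonal matrix of copies of `V`. -/
protected theorem conjMap (V : H →L[ℂ] H) : MatrixPositive (conjMap V) := by
  intro k M hM
  classical
  let D : CStarMatrix (Fin k) (Fin k) (H →L[ℂ] H) :=
    CStarMatrix.ofMatrix (Matrix.diagonal fun _ => V)
  have : M.map (conjMap V) = D * M * star D := by
    refine CStarMatrix.ext fun i j => ?_
    have h1 : ∀ i j, (D * M) i j = V * M i j := fun i j => by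
      exact Matrix.diagonal_mul (fun _ => V) M i j
    have h2 : star D = CStarMatrix.ofMatrix (Matrix.diagonal fun _ => star V) := by
      exact Matrix.diagonal_conjTranspose _
    rw [h2, CStarMatrix.map_apply, conjMap_apply, ← h1]
    exact (Matrix.mul_diagonal (fun _ => star V) (D * M) i j).symm
  rw [this]
  exact star_right_conjugate_nonneg hM D

end MatrixPositive

end CompletePositivity

/-! ### Exponentials of a completely positive map plus a drift -/

section GKLSForm

variable {H : Type*} [NormedAddCommGroup H] [InnerProductSpace ℂ H] [CompleteSpace H]

/-- The map `ρ ↦ V ρ + ρ V†`. -/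
def driftMap (V : H →L[ℂ] H) : (H →L[ℂ] H) →L[ℂ] (H →L[ℂ] H) :=
  ContinuousLinearMap.mulLeftRight ℂ (H →L[ℂ] H) V 1 +
    ContinuousLinearMap.mulLeftRight ℂ (H →L[ℂ] H) 1 (star V)

theorem driftMap_apply (V ρ : H →L[ℂ] H) : driftMap V ρ = V * ρ + ρ * star V := by
  simp [driftMap]

/-- The drift is the cross term of a square. Complete positivity uses this for large `r`, the trace
bounds for `r = 1`. -/
theorem conjMap_add_smul_one (V : H →L[ℂ] H) (r : ℝ) :
    conjMap ((r : ℂ) • 1 + V) =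
      ((r : ℂ) * r) • (1 : (H →L[ℂ] H) →L[ℂ] (H →L[ℂ] H)) + (r : ℂ) • driftMap V + conjMap V := by
  refine ContinuousLinearMap.ext fun ρ => ?_
  have h1 : star ((r : ℂ) • 1 + V) = (r : ℂ) • 1 + star V := by
    simp [star_add, star_smul]
  simp only [add_apply, smul_apply,
    conjMap_apply, driftMap_apply, one_apply_eq_self, h1]
  simp only [add_mul, mul_add, smul_mul_assoc, mul_smul_comm, one_mul, mul_one, smul_add, smul_smul]
  abel

/-- The drift itself is not positive, but completing the square at the cost of `r⁻¹ VρV†` leaves a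
completely positive map minus `r` times the identity. The scalar part only contributes the factor
`e^{-r} > 0`, and the added term vanishes as `r → ∞`. -/
theorem MatrixPositive.exp_add_driftMap {D : (H →L[ℂ] H) →L[ℂ] (H →L[ℂ] H)}
    (hD : MatrixPositive D) (V : H →L[ℂ] H) : MatrixPositive (NormedSpace.exp (D + driftMap V)) := by
  have key : ∀ r : ℝ, 0 < r →
      MatrixPositive (NormedSpace.exp (D + driftMap V + (r⁻¹ : ℂ) • conjMap V)) := by
    intro r hr
    have hr' : (r : ℂ) ≠ 0 := by exact_mod_cast hr.ne'
    have h1 : D + driftMap V + (r⁻¹ : ℂ) • conjMap V =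
        (D + (r⁻¹ : ℂ) • conjMap ((r : ℂ) • 1 + V)) +
          algebraMap ℂ ((H →L[ℂ] H) →L[ℂ] (H →L[ℂ] H)) (-(r : ℂ)) := by
      rw [conjMap_add_smul_one, Algebra.algebraMap_eq_smul_one]
      simp only [smul_add, smul_smul]
      rw [inv_mul_cancel₀ hr', ← mul_assoc, inv_mul_cancel₀ hr']
      module
    let : NormedAlgebra ℚ ((H →L[ℂ] H) →L[ℂ] (H →L[ℂ] H)) := .restrictScalars ℚ ℂ _
    rw [h1, NormedSpace.exp_add_of_commute (Algebra.commutes _ _).symm,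
      ← NormedSpace.algebraMap_exp_comm, Algebra.algebraMap_eq_smul_one, mul_smul_comm, mul_one,
      ← Complex.exp_eq_exp_ℂ]
    have h2 : MatrixPositive (D + (r⁻¹ : ℂ) • conjMap ((r : ℂ) • 1 + V)) := by
      refine hD.add ?_
      have := (MatrixPositive.conjMap ((r : ℂ) • 1 + V)).smul (inv_nonneg.2 hr.le)
      simpa using this
    have := h2.exp.smul (Real.exp_nonneg (-r))
    simpa using this
  refine MatrixPositive.isClosed.mem_of_tendsto (b := atTop)
    (f := fun r : ℝ => NormedSpace.exp (D + driftMap V + (r⁻¹ : ℂ) • conjMap V)) ?_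
    ((eventually_gt_atTop 0).mono key)
  have h0 : Tendsto (fun r : ℝ => ((r⁻¹ : ℝ) : ℂ)) atTop (𝓝 0) :=
    (Complex.continuous_ofReal.tendsto' 0 0 Complex.ofReal_zero).comp tendsto_inv_atTop_zero
  have h1 : Tendsto (fun r : ℝ => D + driftMap V + (r⁻¹ : ℂ) • conjMap V) atTop
      (𝓝 (D + driftMap V)) := by
    have hc : Continuous fun c : ℂ => D + driftMap V + c • conjMap V := by fun_prop
    have := (hc.tendsto' 0 (D + driftMap V)
      ((congrArg _ (zero_smul ℂ (conjMap V))).trans (add_zero _))).comp h0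
    simpa [Function.comp_def] using this
  let : NormedAlgebra ℚ ((H →L[ℂ] H) →L[ℂ] (H →L[ℂ] H)) := .restrictScalars ℚ ℂ _
  exact (NormedSpace.exp_continuous.tendsto _).comp h1

variable {ι : Type*} [Fintype ι]

theorem exists_conjTranspose_mul_self_of_posSemidef {k : Matrix ι ι ℂ} (hk : k.PosSemidef) :
    ∃ X : Matrix ι ι ℂ, k = X.conjTranspose * X := by
  classical
  open scoped MatrixOrder in
  exact CStarAlgebra.nonneg_iff_eq_star_mul_self.1 hk.nonneg

/-- The completely positive part `ρ ↦ ∑ k_{αβ} A_α ρ A_β†` of a generator. -/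
def jumpMap (k : Matrix ι ι ℂ) (A : ι → H →L[ℂ] H) : (H →L[ℂ] H) →L[ℂ] (H →L[ℂ] H) :=
  ∑ α, ∑ β, k α β • ContinuousLinearMap.mulLeftRight ℂ (H →L[ℂ] H) (A α) (star (A β))

/-- Writing `k = X†X` gives a Kraus form with operators `∑_α conj(X_{γα}) A_α`. -/
theorem MatrixPositive.jumpMap {k : Matrix ι ι ℂ} (hk : k.PosSemidef) (A : ι → H →L[ℂ] H) :
    MatrixPositive (jumpMap k A) := by
  classical
  obtain ⟨X, rfl⟩ := exists_conjTranspose_mul_self_of_posSemidef hk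
  have : _root_.jumpMap (X.conjTranspose * X) A = ∑ γ, _root_.conjMap (∑ α, conj (X γ α) • A α) := by
    refine ContinuousLinearMap.ext fun ρ => ?_
    simp only [_root_.jumpMap, _root_.sum_apply, _root_.smul_apply,
      ContinuousLinearMap.mulLeftRight_apply, conjMap_apply, Matrix.mul_apply,
      Matrix.conjTranspose_apply, Finset.sum_mul, Finset.sum_smul, star_sum, star_smul,
      Finset.mul_sum]
    rw [Finset.sum_congr rfl fun α _ => Finset.sum_comm, Finset.sum_comm]
    refine Finset.sum_congr rfl fun γ _ => ?_
    rw [Finset.sum_comm]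
    refine Finset.sum_congr rfl fun α _ => Finset.sum_congr rfl fun β _ => ?_
    simp [smul_smul, mul_comm]
  rw [this]
  exact .sum fun γ _ => .conjMap _

end GKLSForm

/-! ### The generator as jump part plus drift, with the sum over frequencies -/

section GKLSGenerator

variable {H : Type*} [NormedAddCommGroup H] [InnerProductSpace ℂ H] [CompleteSpace H]
variable {ι : Type*} {K : H →L[ℂ] H} {S : Set ℝ} {k : ℝ → Matrix ι ι ℂ}
  {A : ι → ℝ → H →L[ℂ] H}

theorem norm_mulLeftRight_le (A B : H →L[ℂ] H) :
    ‖ContinuousLinearMap.mulLeftRight ℂ (H →L[ℂ] H) A B‖ ≤ ‖A‖ * ‖B‖ :=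
  ContinuousLinearMap.opNorm_mulLeftRight_apply_apply_le ℂ (H →L[ℂ] H) A B

theorem summable_smul_mulLeftRight {α β : ι}
    (hS : Summable fun ω : S => ‖k ω α β‖ * ‖A α ω‖ * ‖A β ω‖) :
    Summable fun ω : S =>
      k ω α β • ContinuousLinearMap.mulLeftRight ℂ (H →L[ℂ] H) (A α ω) (star (A β ω)) := by
  refine .of_norm_bounded hS fun ω => ?_
  rw [norm_smul, mul_assoc]
  gcongr
  simpa using norm_mulLeftRight_le (A α ω) (star (A β ω))

theorem summable_smul_star_mul {α β : ι}
    (hS : Summable fun ω : S => ‖k ω α β‖ * ‖A α ω‖ * ‖A β ω‖) :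
    Summable fun ω : S => k ω α β • (star (A β ω) * A α ω) := by
  refine .of_norm_bounded hS fun ω => ?_
  rw [norm_smul, mul_assoc, mul_comm ‖A α ω‖]
  gcongr
  simpa using norm_mul_le (star (A β ω)) (A α ω)

variable [Fintype ι]

/-- The completely positive part of a generator, summed over the frequencies. -/
def totalJumpMap (S : Set ℝ) (k : ℝ → Matrix ι ι ℂ) (A : ι → ℝ → H →L[ℂ] H) :
    (H →L[ℂ] H) →L[ℂ] (H →L[ℂ] H) :=
  ∑ α, ∑ β, ∑' ω : S,
    k ω α β • ContinuousLinearMap.mulLeftRight ℂ (H →L[ℂ] H) (A α ω) (star (A β ω))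

/-- The total decay operator `∑ k_{αβ}(ω) A_{βω}† A_{αω}`. -/
def totalDecay (S : Set ℝ) (k : ℝ → Matrix ι ι ℂ) (A : ι → ℝ → H →L[ℂ] H) : H →L[ℂ] H :=
  ∑ α, ∑ β, ∑' ω : S, k ω α β • (star (A β ω) * A α ω)

/-- Positivity holds only after summing over `α, β` at fixed `ω`, so the frequency sum is pulled
outside. -/
theorem MatrixPositive.totalJumpMap (hk : ∀ ω, (k ω).PosSemidef)
    (hS : ∀ α β, Summable fun ω : S => ‖k ω α β‖ * ‖A α ω‖ * ‖A β ω‖) :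
    MatrixPositive (totalJumpMap S k A) :=
  .hasSum (hasSum_sum fun α _ => hasSum_sum fun β _ => (summable_smul_mulLeftRight (hS α β)).hasSum)
    fun ω : S => .jumpMap (hk ω) fun α => A α ω

theorem star_totalDecay (hk : ∀ ω, (k ω).PosSemidef) :
    star (totalDecay S k A) = totalDecay S k A := by
  rw [totalDecay, star_sum, Finset.sum_comm]
  refine Finset.sum_congr rfl fun α _ => ?_
  rw [star_sum]
  refine Finset.sum_congr rfl fun β _ => ?_
  rw [tsum_star]
  refine tsum_congr fun ω => ?_
  rw [star_smul, star_mul, star_star, (hk ω).isHermitian.apply]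

/-- With `Γ` the total decay operator, the commutator and anticommutator merge into the drift of `V
= -iK - Γ/2`. Hermiticity of `k` makes `Γ` self-adjoint, which is what lets `V†` appear on the
right. -/
theorem gklsGenerator_eq (hK : IsSelfAdjoint K) (hk : ∀ ω, (k ω).PosSemidef)
    (hS : ∀ α β, Summable fun ω : S => ‖k ω α β‖ * ‖A α ω‖ * ‖A β ω‖) :
    gklsGenerator K S k A =
      totalJumpMap S k A + driftMap (-(Complex.I • K) - (1 / 2 : ℂ) • totalDecay S k A) := by
  refine ContinuousLinearMap.ext fun ρ => ?_
  have hterm : ∀ α β, (∑' ω : S, k ω α β • gklsTerm (A α ω) (A β ω)) ρ =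
      (∑' ω : S, k ω α β • ContinuousLinearMap.mulLeftRight ℂ (H →L[ℂ] H) (A α ω)
        (star (A β ω))) ρ - (1 / 2 : ℂ) • ((∑' ω : S, k ω α β • (star (A β ω) * A α ω)) * ρ +
          ρ * ∑' ω : S, k ω α β • (star (A β ω) * A α ω)) := by
    intro α β
    have h1 := (summable_smul_mulLeftRight (hS α β)).hasSum
    have h2 := (summable_smul_star_mul (hS α β)).hasSum
    -- `T X` is the anticommutator `ρ ↦ Xρ + ρX`; as a bounded linear map of `X` it commutes with
    -- the infinite sum.
    let T : (H →L[ℂ] H) →L[ℂ] (H →L[ℂ] H) →L[ℂ] (H →L[ℂ] H) :=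
      (ContinuousLinearMap.mulLeftRight ℂ (H →L[ℂ] H)).flip 1 +
        ContinuousLinearMap.mulLeftRight ℂ (H →L[ℂ] H) 1
    have h3 := h1.sub ((T.hasSum h2).const_smul (1 / 2 : ℂ))
    have h4 : (fun ω : S => k ω α β • gklsTerm (A α ω) (A β ω)) = fun ω : S =>
        k ω α β • ContinuousLinearMap.mulLeftRight ℂ (H →L[ℂ] H) (A α ω) (star (A β ω)) -
          (1 / 2 : ℂ) • T (k ω α β • (star (A β ω) * A α ω)) := by
      funext ω
      rw [gklsTerm, smul_sub, map_smul, smul_comm (k ω α β) (1 / 2 : ℂ)]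
      rfl
    rw [h4, h3.tsum_eq]
    simp [T]
  have hV : star (-(Complex.I • K) - (1 / 2 : ℂ) • totalDecay S k A) =
      Complex.I • K - (1 / 2 : ℂ) • totalDecay S k A := by
    rw [star_sub, star_neg, star_smul, star_smul, star_totalDecay hk, hK.star_eq]
    simp
  rw [gklsGenerator, add_apply, add_apply, driftMap_apply, hV, hamiltonianTerm_apply]
  simp only [_root_.sum_apply, hterm, Finset.sum_sub_distrib, ← Finset.smul_sum,
    Finset.sum_add_distrib, ← Finset.sum_mul, ← Finset.mul_sum, totalJumpMap]
  simp only [totalDecay, sub_mul, mul_sub, neg_mul, smul_mul_assoc, mul_smul_comm]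
  module

theorem isCompletelyPositive_exp_gklsGenerator (hK : IsSelfAdjoint K)
    (hk : ∀ ω, (k ω).PosSemidef)
    (hS : ∀ α β, Summable fun ω : S => ‖k ω α β‖ * ‖A α ω‖ * ‖A β ω‖) {t : ℝ} (ht : 0 ≤ t) :
    MatrixPositive (NormedSpace.exp ((t : ℂ) • gklsGenerator K S k A)) := by
  rw [gklsGenerator_eq hK hk hS, smul_add]
  have h1 : ∀ V : H →L[ℂ] H, (t : ℂ) • driftMap V = driftMap ((t : ℂ) • V) := by
    intro V
    refine ContinuousLinearMap.ext fun ρ => ?_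
    simp [driftMap_apply, smul_apply, star_smul]
  rw [h1]
  exact ((MatrixPositive.totalJumpMap hk hS).smul ht).exp_add_driftMap _

end GKLSGenerator

/-! ### Traces through absolutely summable diagonals -/

section

open scoped ENNReal

section DiagonalSums

variable {H : Type*} [NormedAddCommGroup H] [InnerProductSpace ℂ H]
  {J : Type*} (b : HilbertBasis J ℂ H)

/-- The sum of the absolute values of the diagonal matrix elements of an operator. -/
def diagSum (T : H →L[ℂ] H) : ℝ≥0∞ := ∑' i, ‖⟪b i, T (b i)⟫_ℂ‖ₑ

theorem summable_norm_of_tsum_enorm_ne_top {E X : Type*} [NormedAddCommGroup E] {f : X → E}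
    (h : ∑' i, ‖f i‖ₑ ≠ ∞) : Summable fun i => ‖f i‖ :=
  NNReal.summable_coe.2 (tsum_enorm_ne_top_iff_summable_nnnorm.1 h)

theorem summable_of_diagSum_ne_top {T : H →L[ℂ] H} (hT : diagSum b T ≠ ∞) :
    Summable fun i => ⟪b i, T (b i)⟫_ℂ :=
  (summable_norm_of_tsum_enorm_ne_top hT).of_norm

theorem diagSum_ne_top_of_summable {T : H →L[ℂ] H} (hT : Summable fun i => ⟪b i, T (b i)⟫_ℂ) :
    diagSum b T ≠ ∞ :=
  tsum_enorm_ne_top_iff_summable_nnnorm.2 (NNReal.summable_coe.1 hT.norm)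

theorem diagSum_add_le (T U : H →L[ℂ] H) : diagSum b (T + U) ≤ diagSum b T + diagSum b U := by
  rw [diagSum, diagSum, diagSum, ← ENNReal.tsum_add]
  refine ENNReal.tsum_le_tsum fun i => ?_
  rw [add_apply, inner_add_right]
  exact enorm_add_le _ _

theorem diagSum_smul (c : ℂ) (T : H →L[ℂ] H) : diagSum b (c • T) = ‖c‖ₑ * diagSum b T := by
  simp [diagSum, enorm_mul, ENNReal.tsum_mul_left]

theorem diagSum_neg (T : H →L[ℂ] H) : diagSum b (-T) = diagSum b T := by
  simp [diagSum]

theorem diagSum_zero : diagSum b (0 : H →L[ℂ] H) = 0 := by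
  simp [diagSum]

theorem diagSum_sub_le (T U : H →L[ℂ] H) : diagSum b (T - U) ≤ diagSum b T + diagSum b U := by
  rw [sub_eq_add_neg, ← diagSum_neg b U]
  exact diagSum_add_le b T (-U)

theorem diagSum_sum_le {X : Type*} (s : Finset X) (T : X → H →L[ℂ] H) :
    diagSum b (∑ x ∈ s, T x) ≤ ∑ x ∈ s, diagSum b (T x) :=
  Finset.le_sum_of_subadditive _ (diagSum_zero b).le (diagSum_add_le b) s T

theorem hasSum_inner_of_hasSum {X : Type*} {T : X → H →L[ℂ] H} {U : H →L[ℂ] H} (h : HasSum T U)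
    (v : H) : HasSum (fun x => ⟪v, T x v⟫_ℂ) ⟪v, U v⟫_ℂ :=
  ((innerSL ℂ v).comp (ContinuousLinearMap.apply ℂ H v)).hasSum h

theorem diagSum_le_tsum {X : Type*} {T : X → H →L[ℂ] H} {U : H →L[ℂ] H} (h : HasSum T U) :
    diagSum b U ≤ ∑' x, diagSum b (T x) := by
  simp only [diagSum]
  rw [ENNReal.tsum_comm]
  refine ENNReal.tsum_le_tsum fun i => ?_
  rw [← (hasSum_inner_of_hasSum h (b i)).tsum_eq]
  exact enorm_tsum_le_tsum_enorm

theorem summable_uncurry_of_tsum_ne_top {X Y E : Type*} [NormedAddCommGroup E] [CompleteSpace E]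
    {f : X → Y → E} (h : ∑' x, ∑' y, ‖f x y‖ₑ ≠ ∞) : Summable (Function.uncurry f) := by
  refine (summable_norm_of_tsum_enorm_ne_top (f := Function.uncurry f) ?_).of_norm
  rw [ENNReal.tsum_prod']
  exact h

/-- Fubini for the double series of diagonal elements; norm convergence alone would not allow the
exchange. -/
theorem opTrace_eq_tsum {X : Type*} {T : X → H →L[ℂ] H} {U : H →L[ℂ] H} (h : HasSum T U)
    (hT : ∑' x, diagSum b (T x) ≠ ∞) : opTrace b U = ∑' x, opTrace b (T x) := by
  have h1 : Summable (Function.uncurry fun x i => ⟪b i, T x (b i)⟫_ℂ) :=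
    summable_uncurry_of_tsum_ne_top hT
  simp only [opTrace]
  rw [h1.tsum_comm.symm]
  exact tsum_congr fun i => (hasSum_inner_of_hasSum h (b i)).tsum_eq.symm

theorem opTrace_add {T U : H →L[ℂ] H} (hT : diagSum b T ≠ ∞) (hU : diagSum b U ≠ ∞) :
    opTrace b (T + U) = opTrace b T + opTrace b U := by
  simp only [opTrace, add_apply, inner_add_right]
  exact (summable_of_diagSum_ne_top b hT).tsum_add (summable_of_diagSum_ne_top b hU)

theorem opTrace_smul (c : ℂ) (T : H →L[ℂ] H) : opTrace b (c • T) = c * opTrace b T := by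
  simp [opTrace, tsum_mul_left]

theorem opTrace_zero : opTrace b (0 : H →L[ℂ] H) = 0 := by
  simp [opTrace]

theorem opTrace_sum_eq_zero {X : Type*} (s : Finset X) (T : X → H →L[ℂ] H)
    (h : ∀ x ∈ s, diagSum b (T x) ≠ ∞ ∧ opTrace b (T x) = 0) :
    diagSum b (∑ x ∈ s, T x) ≠ ∞ ∧ opTrace b (∑ x ∈ s, T x) = 0 := by
  refine Finset.sum_induction _ (fun U => diagSum b U ≠ ∞ ∧ opTrace b U = 0) ?_ ?_ h
  · rintro T U ⟨hT, hT'⟩ ⟨hU, hU'⟩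
    exact ⟨ne_top_of_le_ne_top (ENNReal.add_ne_top.2 ⟨hT, hU⟩) (diagSum_add_le b T U),
      by rw [opTrace_add b hT hU, hT', hU', add_zero]⟩
  · exact ⟨by simp [diagSum_zero], opTrace_zero b⟩

/-! ### Cyclicity -/

theorem enorm_sq_eq_tsum_inner (v : H) : ‖v‖ₑ ^ 2 = ∑' j, ‖⟪b j, v⟫_ℂ‖ₑ ^ 2 := by
  have h := b.hasSum_inner_mul_inner v v
  have h1 : ∀ j, ⟪v, b j⟫_ℂ * ⟪b j, v⟫_ℂ = ((‖⟪b j, v⟫_ℂ‖ ^ 2 : ℝ) : ℂ) := by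
    intro j
    rw [← inner_conj_symm v (b j), ← Complex.normSq_eq_conj_mul_self, Complex.normSq_eq_norm_sq]
  simp only [h1, inner_self_eq_norm_sq_to_K] at h
  have h2 : HasSum (fun j => ‖⟪b j, v⟫_ℂ‖ ^ 2) (‖v‖ ^ 2) := by
    rw [← Complex.hasSum_ofReal]
    simpa using h
  have h3 := ENNReal.ofReal_tsum_of_nonneg (fun j => by positivity) h2.summable
  rw [h2.tsum_eq] at h3
  simpa [ENNReal.ofReal_pow, ofReal_norm] using h3

theorem mul_le_sq_add_sq_ennreal (x y : ℝ≥0∞) : x * y ≤ x ^ 2 + y ^ 2 := by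
  rcases le_total x y with h | h
  · calc x * y ≤ y * y := by gcongr
      _ ≤ x ^ 2 + y ^ 2 := by rw [← sq]; exact le_add_self
  · calc x * y ≤ x * x := by gcongr
      _ ≤ x ^ 2 + y ^ 2 := by rw [← sq]; exact le_self_add

theorem tsum_enorm_inner_le (X Y : H →L[ℂ] H) :
    ∑' i, ‖⟪X (b i), Y (b i)⟫_ℂ‖ₑ ≤ ∑' i, ‖X (b i)‖ₑ ^ 2 + ∑' i, ‖Y (b i)‖ₑ ^ 2 := by
  rw [← ENNReal.tsum_add]
  refine ENNReal.tsum_le_tsum fun i => ?_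
  calc ‖⟪X (b i), Y (b i)⟫_ℂ‖ₑ ≤ ‖X (b i)‖ₑ * ‖Y (b i)‖ₑ := by
        rw [← ofReal_norm, ← ofReal_norm, ← ofReal_norm, ← ENNReal.ofReal_mul (norm_nonneg _)]
        exact ENNReal.ofReal_le_ofReal (norm_inner_le_norm _ _)
    _ ≤ _ := mul_le_sq_add_sq_ennreal _ _

theorem tsum_enorm_sq_mul_le (A R : H →L[ℂ] H) :
    ∑' i, ‖(A * R) (b i)‖ₑ ^ 2 ≤ ‖A‖ₑ ^ 2 * ∑' i, ‖R (b i)‖ₑ ^ 2 := by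
  rw [← ENNReal.tsum_mul_left]
  refine ENNReal.tsum_le_tsum fun i => ?_
  rw [← mul_pow]
  gcongr
  exact A.le_opENorm (R (b i))

variable [CompleteSpace H]

/-- Both sides are the sum of all `|⟨b_j, X b_i⟩|²`, the squared Hilbert–Schmidt norm. -/
theorem tsum_enorm_sq_star (X : H →L[ℂ] H) :
    ∑' i, ‖star X (b i)‖ₑ ^ 2 = ∑' i, ‖X (b i)‖ₑ ^ 2 := by
  simp only [enorm_sq_eq_tsum_inner b]
  rw [ENNReal.tsum_comm]
  refine tsum_congr fun i => tsum_congr fun j => ?_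
  rw [ContinuousLinearMap.star_eq_adjoint, ContinuousLinearMap.adjoint_inner_right,
    ← inner_conj_symm, ← ofReal_norm, RCLike.norm_conj, ofReal_norm]

/-- This is `Tr(X†Y) = Tr(YX†)` for Hilbert–Schmidt operators, by Parseval and an absolutely
convergent double sum. -/
theorem tsum_inner_eq_tsum_inner_star {X Y : H →L[ℂ] H} (hX : ∑' i, ‖X (b i)‖ₑ ^ 2 ≠ ∞)
    (hY : ∑' i, ‖Y (b i)‖ₑ ^ 2 ≠ ∞) :
    ∑' i, ⟪X (b i), Y (b i)⟫_ℂ = ∑' i, ⟪star Y (b i), star X (b i)⟫_ℂ := by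
  have h : Summable (Function.uncurry fun i j => ⟪X (b i), b j⟫_ℂ * ⟪b j, Y (b i)⟫_ℂ) := by
    refine summable_uncurry_of_tsum_ne_top (ne_top_of_le_ne_top (ENNReal.add_ne_top.2 ⟨hX, hY⟩) ?_)
    simp only [enorm_sq_eq_tsum_inner b, ← ENNReal.tsum_add]
    refine ENNReal.tsum_le_tsum fun i => ENNReal.tsum_le_tsum fun j => ?_
    rw [enorm_mul, ← inner_conj_symm (X (b i)), ← ofReal_norm (conj _), RCLike.norm_conj,
      ofReal_norm]
    exact mul_le_sq_add_sq_ennreal _ _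
  rw [tsum_congr fun i => (b.tsum_inner_mul_inner (X (b i)) (Y (b i))).symm,
    tsum_congr fun i => (b.tsum_inner_mul_inner (star Y (b i)) (star X (b i))).symm]
  rw [← h.tsum_comm]
  refine tsum_congr fun j => tsum_congr fun i => ?_
  rw [ContinuousLinearMap.star_eq_adjoint, ContinuousLinearMap.star_eq_adjoint,
    ContinuousLinearMap.adjoint_inner_left, ContinuousLinearMap.adjoint_inner_right, mul_comm]

theorem diagSum_eq_tsum_sqrt {P : H →L[ℂ] H} (hP : 0 ≤ P) :
    diagSum b P = ∑' i, ‖CFC.sqrt P (b i)‖ₑ ^ 2 := by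
  refine tsum_congr fun i => ?_
  have h1 : star (CFC.sqrt P) = CFC.sqrt P := (IsSelfAdjoint.of_nonneg (CFC.sqrt_nonneg P)).star_eq
  have h2 : P (b i) = CFC.sqrt P (CFC.sqrt P (b i)) :=
    congrArg (fun T : H →L[ℂ] H => T (b i)) (CFC.sqrt_mul_sqrt_self P hP).symm
  rw [h2]
  nth_rw 1 [← h1]
  rw [ContinuousLinearMap.star_eq_adjoint, ContinuousLinearMap.adjoint_inner_right,
    inner_self_eq_norm_sq_to_K, enorm_pow]
  congr 1
  rw [← ofReal_norm, ← ofReal_norm]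
  simp

theorem inner_mul_mul_star {P : H →L[ℂ] H} (hP : 0 ≤ P) (A B : H →L[ℂ] H) (v : H) :
    ⟪v, (A * P * star B) v⟫_ℂ = ⟪star (A * CFC.sqrt P) v, star (B * CFC.sqrt P) v⟫_ℂ := by
  have h1 : star (CFC.sqrt P) = CFC.sqrt P := (IsSelfAdjoint.of_nonneg (CFC.sqrt_nonneg P)).star_eq
  rw [ContinuousLinearMap.star_eq_adjoint (A * _), ContinuousLinearMap.adjoint_inner_left, star_mul,
    h1]
  congr 1
  conv_lhs => rw [← CFC.sqrt_mul_sqrt_self P hP]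
  rfl

/-- Split `P` as the square of its root and use cyclicity for the two Hilbert–Schmidt factors. The
right side depends on `A` and `B` only through `B†A`, so all trace cancellations below reduce to
comparing these products. -/
theorem opTrace_mul_mul_star {P : H →L[ℂ] H} (hP : 0 ≤ P) (hP' : diagSum b P ≠ ∞)
    (A B : H →L[ℂ] H) : opTrace b (A * P * star B) =
      ∑' i, ⟪CFC.sqrt P (b i), (star B * A) (CFC.sqrt P (b i))⟫_ℂ := by
  have hfin : ∀ A : H →L[ℂ] H, ∑' i, ‖star (A * CFC.sqrt P) (b i)‖ₑ ^ 2 ≠ ∞ := by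
    intro A
    rw [tsum_enorm_sq_star]
    refine ne_top_of_le_ne_top ?_ (tsum_enorm_sq_mul_le b A (CFC.sqrt P))
    rw [← diagSum_eq_tsum_sqrt b hP]
    exact ENNReal.mul_ne_top (by simp) hP'
  rw [opTrace]
  simp only [inner_mul_mul_star hP]
  rw [tsum_inner_eq_tsum_inner_star b (hfin A) (hfin B), star_star, star_star]
  refine tsum_congr fun i => ?_
  rw [mul_apply_eq_comp, mul_apply_eq_comp, mul_apply_eq_comp,
    ContinuousLinearMap.star_eq_adjoint, ContinuousLinearMap.adjoint_inner_right]

theorem diagSum_mul_mul_star_le {P : H →L[ℂ] H} (hP : 0 ≤ P) (A B : H →L[ℂ] H) :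
    diagSum b (A * P * star B) ≤ 2 * (‖A‖ₑ * ‖B‖ₑ * diagSum b P) := by
  -- The estimate by a sum of squares is not homogeneous in `A` and `B`; normalising both restores
  -- the product of norms. The factor `2` comes from the crude `xy ≤ x² + y²`.
  have hunit : ∀ A B : H →L[ℂ] H, ‖A‖ₑ ≤ 1 → ‖B‖ₑ ≤ 1 →
      diagSum b (A * P * star B) ≤ 2 * diagSum b P := by
    intro A B hA hB
    rw [diagSum]
    simp only [inner_mul_mul_star hP]
    refine (tsum_enorm_inner_le b _ _).trans ?_
    rw [tsum_enorm_sq_star, tsum_enorm_sq_star, two_mul, diagSum_eq_tsum_sqrt b hP]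
    have : ∀ A : H →L[ℂ] H, ‖A‖ₑ ≤ 1 →
        ∑' i, ‖(A * CFC.sqrt P) (b i)‖ₑ ^ 2 ≤ ∑' i, ‖CFC.sqrt P (b i)‖ₑ ^ 2 := fun A hA =>
      (tsum_enorm_sq_mul_le b A _).trans (mul_le_of_le_one_left' (pow_le_one' hA 2))
    exact add_le_add (this A hA) (this B hB)
  have hnorm : ∀ A : H →L[ℂ] H, ∃ A' : H →L[ℂ] H, ‖A'‖ₑ ≤ 1 ∧ A = (‖A‖ : ℂ) • A' := by
    intro A
    by_cases hA : A = 0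
    · exact ⟨0, by simp, by simp [hA]⟩
    · have hA' : ‖A‖ ≠ 0 := norm_ne_zero_iff.2 hA
      refine ⟨(‖A‖⁻¹ : ℂ) • A, ?_, ?_⟩
      · rw [enorm_smul, ← ofReal_norm, ← ofReal_norm, ← ENNReal.ofReal_mul (norm_nonneg _)]
        simp [hA']
      · rw [smul_smul, mul_inv_cancel₀ (by exact_mod_cast hA'), one_smul]
  obtain ⟨A', hA', hA⟩ := hnorm A
  obtain ⟨B', hB', hB⟩ := hnorm B
  have h1 : A * P * star B = ((‖A‖ : ℂ) * ‖B‖) • (A' * P * star B') := by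
    conv_lhs => rw [hA, hB]
    rw [star_smul, smul_mul_assoc, smul_mul_assoc, mul_smul_comm, smul_smul, RCLike.star_def,
      Complex.conj_ofReal]
  have h2 : ‖(‖A‖ : ℂ) * (‖B‖ : ℂ)‖ₑ = ‖A‖ₑ * ‖B‖ₑ := by
    rw [enorm_mul, ← ofReal_norm, ← ofReal_norm, ← ofReal_norm, ← ofReal_norm]
    simp
  rw [h1, diagSum_smul, h2, mul_left_comm]
  gcongr
  exact hunit A' B' hA' hB'

end DiagonalSums

end

/-! ### Trace preservation of the exponential -/

section

open scoped ENNReal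

theorem hasSum_exp_smul {B : Type*} [NormedRing B] [NormedAlgebra ℂ B] [CompleteSpace B] (t : ℂ)
    (X : B) :
    HasSum (fun n : ℕ => ((n.factorial : ℂ)⁻¹ * t ^ n) • X ^ n) (NormedSpace.exp (t • X)) := by
  have h1 := NormedSpace.exp_series_hasSum_exp' (𝕂 := ℂ) (t • X)
  simpa only [smul_pow, smul_smul] using h1

theorem hasSum_exp_smul_apply {X : Type*} [NormedAddCommGroup X] [NormedSpace ℂ X] [CompleteSpace X]
    (t : ℂ) (Λ : X →L[ℂ] X) (x : X) :
    HasSum (fun n : ℕ => ((n.factorial : ℂ)⁻¹ * t ^ n) • (Λ ^ n) x)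
      (NormedSpace.exp (t • Λ) x) := by
  simpa using (ContinuousLinearMap.apply ℂ X x).hasSum (hasSum_exp_smul t Λ)

section TracePreservation

variable {H : Type*} [NormedAddCommGroup H] [InnerProductSpace ℂ H] 
  {J : Type*} (b : HilbertBasis J ℂ H)

theorem isTraceClass_of_nonneg {P : H →L[ℂ] H} (hP : 0 ≤ P) (hP' : diagSum b P ≠ ∞) :
    IsTraceClass b P :=
  Submodule.subset_span ⟨hP, summable_of_diagSum_ne_top b hP'⟩

theorem IsTraceClass.induction {p : (H →L[ℂ] H) → Prop}
    (pos : ∀ P : H →L[ℂ] H, 0 ≤ P → diagSum b P ≠ ∞ → p P) (zero : p 0)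
    (add : ∀ T U : H →L[ℂ] H, p T → p U → p (T + U)) (smul : ∀ (c : ℂ) (T : H →L[ℂ] H), p T → p (c • T))
    {T : H →L[ℂ] H} (hT : IsTraceClass b T) : p T :=
  Submodule.span_induction (fun P hP => pos P hP.1 (diagSum_ne_top_of_summable b hP.2)) zero
    (fun T U _ _ => add T U) (fun c T _ => smul c T) hT

theorem tsum_enorm_coefficients_ne_top {ι : Type*} {S : Set ℝ} {k : ℝ → Matrix ι ι ℂ}
    {A : ι → ℝ → H →L[ℂ] H} {α β : ι}
    (hS : Summable fun ω : S => ‖k ω α β‖ * ‖A α ω‖ * ‖A β ω‖) :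
    ∑' ω : S, ‖k ω α β‖ₑ * (‖A α ω‖ₑ * ‖A β ω‖ₑ) ≠ ∞ := by
  have h := hS.tsum_ofReal_ne_top
  convert h using 3 with ω
  rw [mul_assoc, ENNReal.ofReal_mul (norm_nonneg _), ENNReal.ofReal_mul (norm_nonneg _),
    ofReal_norm, ofReal_norm, ofReal_norm]

variable [CompleteSpace H]

/-- A positive map that increases the diagonal sums of positive operators by at most a constant
factor. -/
def TraceBounded (Φ : (H →L[ℂ] H) →L[ℂ] (H →L[ℂ] H)) (C : ℝ≥0∞) : Prop :=
  ∀ P : H →L[ℂ] H, 0 ≤ P → 0 ≤ Φ P ∧ diagSum b (Φ P) ≤ C * diagSum b P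

variable {b}

theorem TraceBounded.add {Φ Ψ : (H →L[ℂ] H) →L[ℂ] (H →L[ℂ] H)} {C D : ℝ≥0∞}
    (hΦ : TraceBounded b Φ C) (hΨ : TraceBounded b Ψ D) : TraceBounded b (Φ + Ψ) (C + D) := by
  intro P hP
  refine ⟨add_nonneg (hΦ P hP).1 (hΨ P hP).1, (diagSum_add_le b _ _).trans ?_⟩
  rw [add_mul]
  exact add_le_add (hΦ P hP).2 (hΨ P hP).2

theorem traceBounded_smul_conjMap {r : ℝ} (hr : 0 ≤ r) (V : H →L[ℂ] H) :
    TraceBounded b ((r : ℂ) • conjMap V) (‖(r : ℂ)‖ₑ * (2 * (‖V‖ₑ * ‖V‖ₑ))) := by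
  intro P hP
  refine ⟨((MatrixPositive.conjMap V).smul hr).nonneg hP, ?_⟩
  rw [smul_apply, diagSum_smul, conjMap_apply, mul_assoc ‖(r : ℂ)‖ₑ]
  refine mul_le_mul_right ?_ _
  simpa only [mul_assoc] using diagSum_mul_mul_star_le b hP V V

/-- Iterates of a difference of two trace-bounded positive maps. -/
theorem exists_pow_sub_eq {Φ Ψ : (H →L[ℂ] H) →L[ℂ] (H →L[ℂ] H)} {C D : ℝ≥0∞}
    (hΦ : TraceBounded b Φ C) (hΨ : TraceBounded b Ψ D) {P : H →L[ℂ] H} (hP : 0 ≤ P) (n : ℕ) :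
    ∃ Q R : H →L[ℂ] H, 0 ≤ Q ∧ 0 ≤ R ∧ ((Φ - Ψ) ^ n) P = Q - R ∧
      diagSum b Q + diagSum b R ≤ (C + D) ^ n * diagSum b P := by
  induction n with
  | zero => exact ⟨P, 0, hP, le_rfl, by simp, by simp [diagSum_zero]⟩
  | succ n ih =>
    obtain ⟨Q, R, hQ, hR, h, hle⟩ := ih
    -- Expanding `(Φ - Ψ)(Q - R)` and grouping the terms by sign keeps both parts positive.
    refine ⟨Φ Q + Ψ R, Φ R + Ψ Q, add_nonneg (hΦ Q hQ).1 (hΨ R hR).1,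
      add_nonneg (hΦ R hR).1 (hΨ Q hQ).1, ?_, ?_⟩
    · rw [pow_succ', mul_apply_eq_comp, h]
      simp only [sub_apply, map_sub]
      abel
    · calc diagSum b (Φ Q + Ψ R) + diagSum b (Φ R + Ψ Q)
          ≤ (C * diagSum b Q + D * diagSum b R) + (C * diagSum b R + D * diagSum b Q) :=
            add_le_add
              ((diagSum_add_le b _ _).trans (add_le_add (hΦ Q hQ).2 (hΨ R hR).2))
              ((diagSum_add_le b _ _).trans (add_le_add (hΦ R hR).2 (hΨ Q hQ).2))
        _ = (C + D) * (diagSum b Q + diagSum b R) := by ring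
        _ ≤ (C + D) * ((C + D) ^ n * diagSum b P) := by gcongr
        _ = (C + D) ^ (n + 1) * diagSum b P := by ring

/-- A difference of trace-bounded positive maps that annihilates the trace generates trace
preserving maps, as soon as these are positive. -/
theorem isTraceClass_exp_apply {Φ Ψ : (H →L[ℂ] H) →L[ℂ] (H →L[ℂ] H)} {C D : ℝ≥0∞}
    (hC : C ≠ ∞) (hD : D ≠ ∞) (hΦ : TraceBounded b Φ C) (hΨ : TraceBounded b Ψ D)
    (htr : ∀ P : H →L[ℂ] H, 0 ≤ P → diagSum b P ≠ ∞ → opTrace b ((Φ - Ψ) P) = 0) (t : ℂ)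
    (hpos : ∀ P : H →L[ℂ] H, 0 ≤ P → 0 ≤ NormedSpace.exp (t • (Φ - Ψ)) P) {T : H →L[ℂ] H}
    (hT : IsTraceClass b T) :
    IsTraceClass b (NormedSpace.exp (t • (Φ - Ψ)) T) ∧
      opTrace b (NormedSpace.exp (t • (Φ - Ψ)) T) = opTrace b T := by
  have main : ∀ P : H →L[ℂ] H, 0 ≤ P → diagSum b P ≠ ∞ →
      diagSum b (NormedSpace.exp (t • (Φ - Ψ)) P) ≠ ∞ ∧
        opTrace b (NormedSpace.exp (t • (Φ - Ψ)) P) = opTrace b P := by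
    intro P hP hP'
    have hs := hasSum_exp_smul_apply t (Φ - Ψ) P
    have hbound : ∀ n : ℕ, diagSum b (((n.factorial : ℂ)⁻¹ * t ^ n) • ((Φ - Ψ) ^ n) P) ≤
        ENNReal.ofReal ((‖t‖ * (C + D).toReal) ^ n / n.factorial) * diagSum b P := by
      intro n
      obtain ⟨Q, R, -, -, h, hle⟩ := exists_pow_sub_eq hΦ hΨ hP n
      have h1 : ‖(n.factorial : ℂ)⁻¹ * t ^ n‖ₑ * (C + D) ^ n =
          ENNReal.ofReal ((‖t‖ * (C + D).toReal) ^ n / n.factorial) := by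
        rw [← ENNReal.ofReal_toReal (ENNReal.add_ne_top.2 ⟨hC, hD⟩), ← ofReal_norm,
          ← ENNReal.ofReal_pow ENNReal.toReal_nonneg, ← ENNReal.ofReal_mul (norm_nonneg _),
          ENNReal.toReal_ofReal ENNReal.toReal_nonneg]
        congr 1
        simp only [norm_mul, norm_inv, norm_pow, Complex.norm_natCast]
        ring
      rw [diagSum_smul, h, ← h1, mul_assoc]
      gcongr
      exact (diagSum_sub_le b Q R).trans hle
    have hfin : ∑' n : ℕ, diagSum b (((n.factorial : ℂ)⁻¹ * t ^ n) • ((Φ - Ψ) ^ n) P) ≠ ∞ := by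
      refine ne_top_of_le_ne_top ?_ (ENNReal.tsum_le_tsum hbound)
      rw [ENNReal.tsum_mul_right]
      refine ENNReal.mul_ne_top ?_ hP'
      exact (Real.summable_pow_div_factorial _).tsum_ofReal_ne_top
    refine ⟨ne_top_of_le_ne_top hfin (diagSum_le_tsum b hs), ?_⟩
    -- Only the zeroth term survives: a higher one is the generator applied to a difference of
    -- positive operators of finite trace, where `htr` applies to each.
    rw [opTrace_eq_tsum b hs hfin, tsum_eq_single 0]
    · simp
    · intro n hn
      obtain ⟨m, rfl⟩ := Nat.exists_eq_succ_of_ne_zero hn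
      obtain ⟨Q, R, hQ, hR, h, hle⟩ := exists_pow_sub_eq hΦ hΨ hP m
      have hQR : diagSum b Q + diagSum b R ≠ ∞ := ne_top_of_le_ne_top (ENNReal.mul_ne_top
        (ENNReal.pow_ne_top (ENNReal.add_ne_top.2 ⟨hC, hD⟩)) hP') hle
      obtain ⟨hQ', hR'⟩ := ENNReal.add_ne_top.1 hQR
      have hL : ∀ X : H →L[ℂ] H, 0 ≤ X → diagSum b X ≠ ∞ → diagSum b ((Φ - Ψ) X) ≠ ∞ := by
        intro X hX hX'
        refine ne_top_of_le_ne_top (ENNReal.add_ne_top.2 ⟨?_, ?_⟩) (diagSum_sub_le b (Φ X) (Ψ X))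
        · exact ne_top_of_le_ne_top (ENNReal.mul_ne_top hC hX') (hΦ X hX).2
        · exact ne_top_of_le_ne_top (ENNReal.mul_ne_top hD hX') (hΨ X hX).2
      rw [opTrace_smul, Nat.succ_eq_add_one, pow_succ' (Φ - Ψ), mul_apply_eq_comp, h,
        sub_eq_add_neg Q R, map_add, map_neg, ← neg_one_smul ℂ ((Φ - Ψ) R),
        opTrace_add b (hL Q hQ hQ') (by rw [diagSum_smul]; simpa using hL R hR hR'),
        opTrace_smul, htr Q hQ hQ', htr R hR hR']
      simp
  constructor
  · refine IsTraceClass.induction b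
      (p := fun T => IsTraceClass b (NormedSpace.exp (t • (Φ - Ψ)) T)) ?_ ?_ ?_ ?_ hT
    · exact fun P hP hP' => isTraceClass_of_nonneg b (hpos P hP) (main P hP hP').1
    · rw [map_zero]
      exact Submodule.zero_mem _
    · intro T U hT hU
      rw [map_add]
      exact Submodule.add_mem _ hT hU
    · intro c T hT
      rw [map_smul]
      exact Submodule.smul_mem _ c hT
  -- Finiteness of both diagonal sums is carried along because `opTrace` is additive only under it.
  · refine (IsTraceClass.induction b
      (p := fun T => diagSum b T ≠ ∞ ∧ diagSum b (NormedSpace.exp (t • (Φ - Ψ)) T) ≠ ∞ ∧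
        opTrace b (NormedSpace.exp (t • (Φ - Ψ)) T) = opTrace b T) ?_ ?_ ?_ ?_ hT).2.2
    · exact fun P hP hP' => ⟨hP', main P hP hP'⟩
    · rw [map_zero]
      simp [diagSum_zero]
    · rintro T U ⟨hT, hT', hT''⟩ ⟨hU, hU', hU''⟩
      rw [map_add, opTrace_add b hT' hU', opTrace_add b hT hU, hT'', hU'']
      exact ⟨ne_top_of_le_ne_top (ENNReal.add_ne_top.2 ⟨hT, hU⟩) (diagSum_add_le b _ _),
        ne_top_of_le_ne_top (ENNReal.add_ne_top.2 ⟨hT', hU'⟩) (diagSum_add_le b _ _), rfl⟩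
    · rintro c T ⟨hT, hT', hT''⟩
      rw [map_smul, opTrace_smul, opTrace_smul, hT'', diagSum_smul, diagSum_smul]
      exact ⟨ENNReal.mul_ne_top (by simp) hT, ENNReal.mul_ne_top (by simp) hT', rfl⟩

/-! ### The generator -/

theorem opTrace_hamiltonianTerm (K : H →L[ℂ] H) {P : H →L[ℂ] H} (hP : 0 ≤ P)
    (hP' : diagSum b P ≠ ∞) :
    diagSum b (hamiltonianTerm K P) ≠ ∞ ∧ opTrace b (hamiltonianTerm K P) = 0 := by
  have h1 := opTrace_mul_mul_star b hP hP' K 1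
  have h2 := opTrace_mul_mul_star b hP hP' 1 (star K)
  have h3 := diagSum_mul_mul_star_le b hP K 1
  have h4 := diagSum_mul_mul_star_le b hP 1 (star K)
  have h5 : ∀ A B : H →L[ℂ] H, 2 * (‖A‖ₑ * ‖B‖ₑ * diagSum b P) ≠ ∞ := fun A B =>
    ENNReal.mul_ne_top (by simp) (ENNReal.mul_ne_top (ENNReal.mul_ne_top (by simp) (by simp)) hP')
  replace h3 := ne_top_of_le_ne_top (h5 _ _) h3
  replace h4 := ne_top_of_le_ne_top (h5 _ _) h4
  simp only [star_one, mul_one, one_mul, star_star] at h1 h2 h3 h4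
  have h6 : hamiltonianTerm K P = (-Complex.I) • (K * P) + Complex.I • (P * K) := by
    rw [hamiltonianTerm_apply]
    module
  have h7 : ∀ (c : ℂ) {T : H →L[ℂ] H}, diagSum b T ≠ ∞ → diagSum b (c • T) ≠ ∞ := by
    intro c T hT
    rw [diagSum_smul]
    exact ENNReal.mul_ne_top (by simp) hT
  rw [h6]
  refine ⟨ne_top_of_le_ne_top (ENNReal.add_ne_top.2 ⟨h7 _ h3, h7 _ h4⟩) (diagSum_add_le b _ _), ?_⟩
  rw [opTrace_add b (h7 _ h3) (h7 _ h4), opTrace_smul, opTrace_smul, h1, h2]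
  ring

/-- The jump term and both halves of the anticommutator have the same product `B†A`, hence equal
traces, with weights `1 - ½ - ½`. -/
theorem opTrace_gklsTerm (A B : H →L[ℂ] H) {P : H →L[ℂ] H} (hP : 0 ≤ P)
    (hP' : diagSum b P ≠ ∞) :
    diagSum b (gklsTerm A B P) ≤ 4 * (‖A‖ₑ * ‖B‖ₑ * diagSum b P) ∧
      opTrace b (gklsTerm A B P) = 0 := by
  have h1 := opTrace_mul_mul_star b hP hP' A B
  have h2 := opTrace_mul_mul_star b hP hP' (star B * A) 1
  have h3 := opTrace_mul_mul_star b hP hP' 1 (star (star B * A))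
  have d1 := diagSum_mul_mul_star_le b hP A B
  have d2 := diagSum_mul_mul_star_le b hP (star B * A) 1
  have d3 := diagSum_mul_mul_star_le b hP 1 (star (star B * A))
  have hn : ‖star B * A‖ₑ ≤ ‖A‖ₑ * ‖B‖ₑ := by
    rw [← ofReal_norm, ← ofReal_norm, ← ofReal_norm, ← ENNReal.ofReal_mul (norm_nonneg _)]
    refine ENNReal.ofReal_le_ofReal ((norm_mul_le _ _).trans ?_)
    rw [norm_star, mul_comm]
  -- Only an inequality, since the identity has norm zero on the trivial space.
  have h1e : ‖(1 : H →L[ℂ] H)‖ₑ ≤ 1 := by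
    rw [← ofReal_norm, ENNReal.ofReal_le_one]
    exact ContinuousLinearMap.norm_id_le
  replace d2 : diagSum b (star B * A * P) ≤ 2 * (‖A‖ₑ * ‖B‖ₑ * diagSum b P) := by
    rw [star_one, mul_one] at d2
    refine d2.trans (mul_le_mul_right (mul_le_mul_left ?_ _) _)
    simpa using mul_le_mul' hn h1e
  replace d3 : diagSum b (P * (star B * A)) ≤ 2 * (‖A‖ₑ * ‖B‖ₑ * diagSum b P) := by
    rw [star_star, one_mul] at d3
    refine d3.trans (mul_le_mul_right (mul_le_mul_left ?_ _) _)
    rw [← ofReal_norm (star (star B * A)), norm_star, ofReal_norm]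
    simpa using mul_le_mul' h1e hn
  have hfin : 2 * (‖A‖ₑ * ‖B‖ₑ * diagSum b P) ≠ ∞ :=
    ENNReal.mul_ne_top (by simp) (ENNReal.mul_ne_top (ENNReal.mul_ne_top (by simp) (by simp)) hP')
  have e1 := ne_top_of_le_ne_top hfin d1
  have e2 := ne_top_of_le_ne_top hfin d2
  have e3 := ne_top_of_le_ne_top hfin d3
  simp only [star_one, mul_one, one_mul, star_star] at h2 h3
  have hs : gklsTerm A B P =
      A * P * star B + (-(1 / 2) : ℂ) • (star B * A * P + P * (star B * A)) := by
    rw [gklsTerm_apply]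
    module
  have hd : diagSum b ((-(1 / 2) : ℂ) • (star B * A * P + P * (star B * A))) ≤
      2 * (‖A‖ₑ * ‖B‖ₑ * diagSum b P) := by
    rw [diagSum_smul]
    have h2 : ‖(-(1 / 2) : ℂ)‖ₑ = 2⁻¹ := by
      rw [← ofReal_norm]
      simp [ENNReal.ofReal_inv_of_pos]
    rw [h2]
    calc (2 : ℝ≥0∞)⁻¹ * diagSum b (star B * A * P + P * (star B * A))
        ≤ 2⁻¹ * (2 * (‖A‖ₑ * ‖B‖ₑ * diagSum b P) + 2 * (‖A‖ₑ * ‖B‖ₑ * diagSum b P)) := by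
          gcongr
          exact (diagSum_add_le b _ _).trans (add_le_add d2 d3)
      _ = 2 * (‖A‖ₑ * ‖B‖ₑ * diagSum b P) := by
          rw [← two_mul, ← mul_assoc, ENNReal.inv_mul_cancel (by simp) (by simp), one_mul]
  rw [hs]
  constructor
  · calc _ ≤ 2 * (‖A‖ₑ * ‖B‖ₑ * diagSum b P) + 2 * (‖A‖ₑ * ‖B‖ₑ * diagSum b P) :=
        (diagSum_add_le b _ _).trans (add_le_add d1 hd)
      _ = 4 * (‖A‖ₑ * ‖B‖ₑ * diagSum b P) := by ring
  · rw [opTrace_add b e1 (ne_top_of_le_ne_top hfin hd), opTrace_smul, opTrace_add b e2 e3, h1, h2, h3]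
    ring

variable {ι : Type*} {K : H →L[ℂ] H} {S : Set ℝ} {k : ℝ → Matrix ι ι ℂ} {A : ι → ℝ → H →L[ℂ] H}

theorem summable_smul_gklsTerm {α β : ι}
    (hS : Summable fun ω : S => ‖k ω α β‖ * ‖A α ω‖ * ‖A β ω‖) :
    Summable fun ω : S => k ω α β • gklsTerm (A α ω) (A β ω) := by
  have h1 := summable_smul_mulLeftRight hS
  have h2 := summable_smul_star_mul hS
  let T : (H →L[ℂ] H) →L[ℂ] (H →L[ℂ] H) →L[ℂ] (H →L[ℂ] H) :=
    (ContinuousLinearMap.mulLeftRight ℂ (H →L[ℂ] H)).flip 1 +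
      ContinuousLinearMap.mulLeftRight ℂ (H →L[ℂ] H) 1
  refine (h1.sub ((T.summable h2).const_smul (1 / 2 : ℂ))).congr fun ω => ?_
  rw [gklsTerm, smul_sub, map_smul, smul_comm (k ω α β) (1 / 2 : ℂ)]
  rfl

variable [Fintype ι]

theorem opTrace_gklsGenerator
    (hS : ∀ α β, Summable fun ω : S => ‖k ω α β‖ * ‖A α ω‖ * ‖A β ω‖) {P : H →L[ℂ] H}
    (hP : 0 ≤ P) (hP' : diagSum b P ≠ ∞) : opTrace b (gklsGenerator K S k A P) = 0 := by
  have h1 := opTrace_hamiltonianTerm K hP hP'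
  have h2 : ∀ α β, diagSum b ((∑' ω : S, k ω α β • gklsTerm (A α ω) (A β ω)) P) ≠ ∞ ∧
      opTrace b ((∑' ω : S, k ω α β • gklsTerm (A α ω) (A β ω)) P) = 0 := by
    intro α β
    have hs := (ContinuousLinearMap.apply ℂ (H →L[ℂ] H) P).hasSum
      (summable_smul_gklsTerm (hS α β)).hasSum
    simp only [ContinuousLinearMap.apply_apply, smul_apply] at hs
    have hfin : ∑' ω : S, diagSum b (k ω α β • gklsTerm (A α ω) (A β ω) P) ≠ ∞ := by
      refine ne_top_of_le_ne_top (ENNReal.mul_ne_top (ENNReal.mul_ne_top (by simp : (4 : ℝ≥0∞) ≠ ∞)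
        (tsum_enorm_coefficients_ne_top (hS α β))) hP') ?_
      rw [← ENNReal.tsum_mul_left, ← ENNReal.tsum_mul_right]
      refine ENNReal.tsum_le_tsum fun ω => ?_
      rw [diagSum_smul]
      calc _ ≤ ‖k ω α β‖ₑ * (4 * (‖A α ω‖ₑ * ‖A β ω‖ₑ * diagSum b P)) := by
            gcongr
            exact (opTrace_gklsTerm _ _ hP hP').1
        _ = _ := by ring
    refine ⟨ne_top_of_le_ne_top hfin (diagSum_le_tsum b hs), ?_⟩
    rw [opTrace_eq_tsum b hs hfin]
    simp [opTrace_smul, (opTrace_gklsTerm _ _ hP hP').2]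
  have h3 := opTrace_sum_eq_zero b Finset.univ _ fun α _ =>
    opTrace_sum_eq_zero b Finset.univ _ fun β _ => h2 α β
  rw [gklsGenerator, add_apply]
  simp only [_root_.sum_apply]
  rw [opTrace_add b h1.1 h3.1, h1.2, h3.2, add_zero]

theorem traceBounded_totalJumpMap (hk : ∀ ω, (k ω).PosSemidef)
    (hS : ∀ α β, Summable fun ω : S => ‖k ω α β‖ * ‖A α ω‖ * ‖A β ω‖) :
    ∃ C : ℝ≥0∞, C ≠ ∞ ∧ TraceBounded b (totalJumpMap S k A) C := by
  refine ⟨∑ α, ∑ β, 2 * ∑' ω : S, ‖k ω α β‖ₑ * (‖A α ω‖ₑ * ‖A β ω‖ₑ), ?_, fun P hP =>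
    ⟨(MatrixPositive.totalJumpMap hk hS).nonneg hP, ?_⟩⟩
  · exact ENNReal.sum_ne_top.2 fun α _ => ENNReal.sum_ne_top.2 fun β _ =>
      ENNReal.mul_ne_top (by simp) (tsum_enorm_coefficients_ne_top (hS α β))
  · simp only [totalJumpMap, _root_.sum_apply, Finset.sum_mul]
    refine (diagSum_sum_le b _ _).trans (Finset.sum_le_sum fun α _ => ?_)
    refine (diagSum_sum_le b _ _).trans (Finset.sum_le_sum fun β _ => ?_)
    have hs := (ContinuousLinearMap.apply ℂ (H →L[ℂ] H) P).hasSum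
      (summable_smul_mulLeftRight (hS α β)).hasSum
    refine (diagSum_le_tsum b hs).trans ?_
    rw [← ENNReal.tsum_mul_left, ← ENNReal.tsum_mul_right]
    refine ENNReal.tsum_le_tsum fun ω => ?_
    simp only [ContinuousLinearMap.apply_apply, smul_apply, ContinuousLinearMap.mulLeftRight_apply,
      diagSum_smul]
    calc _ ≤ ‖k ω α β‖ₑ * (2 * (‖A α ω‖ₑ * ‖A β ω‖ₑ * diagSum b P)) := by
          gcongr
          exact diagSum_mul_mul_star_le b hP _ _
      _ = _ := by ring

theorem isCPTPGenerator_gklsGenerator (hK : IsSelfAdjoint K) (hk : ∀ ω, (k ω).PosSemidef)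
    (hS : ∀ α β, Summable fun ω : S => ‖k ω α β‖ * ‖A α ω‖ * ‖A β ω‖) :
    IsCPTPGenerator (gklsGenerator K S k A) := by
  intro t ht
  have hcp := isCompletelyPositive_exp_gklsGenerator hK hk hS ht
  refine ⟨hcp.isCompletelyPositive, fun s b T hT => ?_⟩
  obtain ⟨C, hC, hD⟩ := traceBounded_totalJumpMap (b := b) hk hS
  set V : H →L[ℂ] H := -(Complex.I • K) - (1 / 2 : ℂ) • totalDecay S k A with hV
  -- By polarisation, the drift of `V` is half the difference of the conjugations by `1 + V` and `1
  -- - V`. This exhibits the generator as a difference of trace-bounded positive maps.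
  have hL : gklsGenerator K S k A =
      (totalJumpMap S k A + ((1 / 2 : ℝ) : ℂ) • conjMap (1 + V)) -
        ((1 / 2 : ℝ) : ℂ) • conjMap (1 + -V) := by
    have h1 := conjMap_add_smul_one V 1
    have h2 := conjMap_add_smul_one (-V) 1
    have h3 : driftMap (-V) = -driftMap V := by
      refine ContinuousLinearMap.ext fun ρ => ?_
      simp [driftMap_apply]
      abel
    have h4 : conjMap (-V) = conjMap V := by
      refine ContinuousLinearMap.ext fun ρ => ?_
      simp [conjMap_apply]
    rw [Complex.ofReal_one, one_smul, one_smul, one_mul, one_smul] at h1 h2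
    rw [gklsGenerator_eq hK hk hS, h1, h2, h3, h4]
    push_cast
    module
  have hfin : ∀ W : H →L[ℂ] H, ‖((1 / 2 : ℝ) : ℂ)‖ₑ * (2 * (‖W‖ₑ * ‖W‖ₑ)) ≠ ∞ := fun W =>
    ENNReal.mul_ne_top (by simp) (ENNReal.mul_ne_top (by simp)
      (ENNReal.mul_ne_top (by simp) (by simp)))
  have htr : ∀ P : H →L[ℂ] H, 0 ≤ P → diagSum b P ≠ ∞ →
      opTrace b (gklsGenerator K S k A P) = 0 := fun P hP hP' => opTrace_gklsGenerator hS hP hP'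
  have hpos := fun (P : H →L[ℂ] H) (hP : 0 ≤ P) => hcp.nonneg hP
  rw [hL] at htr hpos ⊢
  exact isTraceClass_exp_apply (ENNReal.add_ne_top.2 ⟨hC, hfin _⟩) (hfin _)
    (hD.add (traceBounded_smul_conjMap (by norm_num) _)) (traceBounded_smul_conjMap (by norm_num) _)
    htr t hpos hT

end TracePreservation

end

/-! ### Continuity of translations on Schwartz space -/

section Translation

variable {E F : Type*} [NormedAddCommGroup E] [NormedSpace ℝ E] [NormedAddCommGroup F]
  [NormedSpace ℝ F] [NormedSpace ℂ F] [SMulCommClass ℝ ℂ F]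

theorem exists_seminorm_compSubConstCLM_sub_le (f : 𝓢(E, F)) (k n : ℕ) :
    ∃ C : ℝ, 0 ≤ C ∧ ∀ a : E, ‖a‖ ≤ 1 →
      SchwartzMap.seminorm ℂ k n (f.compSubConstCLM ℂ a - f) ≤ C * ‖a‖ := by
  set M := 2 ^ k * (Finset.Iic (k, n + 1)).sup
    (fun m => SchwartzMap.seminorm ℂ (E := E) (F := F) m.1 m.2) f with hM
  have hM0 : 0 ≤ M := by positivity
  have hb : ∀ x, (1 + ‖x‖) ^ k * ‖iteratedFDeriv ℝ (n + 1) f x‖ ≤ M := fun x =>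
    SchwartzMap.one_add_le_sup_seminorm_apply (m := (k, n + 1)) le_rfl le_rfl f x
  refine ⟨M, hM0, fun a ha => SchwartzMap.seminorm_le_bound ℂ k n _ (by positivity) fun x => ?_⟩
  have hd : iteratedFDeriv ℝ n (f.compSubConstCLM ℂ a - f : 𝓢(E, F)) x =
      iteratedFDeriv ℝ n f (x - a) - iteratedFDeriv ℝ n f x := by
    have h1 : ((f.compSubConstCLM ℂ a - f : 𝓢(E, F)) : E → F) =
        (fun z => f (z - a)) - (f : E → F) := by
      ext z
      simp
    rw [h1, iteratedFDeriv_sub_apply, iteratedFDeriv_comp_sub]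
    · exact ((f.smooth n).comp (contDiff_id.sub contDiff_const)).contDiffAt
    · exact (f.smooth n).contDiffAt
  rw [hd]
  -- The point `x = 0` is separated because the derivative bound on the ball divides by `‖x‖^k`. On
  -- that ball `‖x‖ ≤ 1 + ‖y‖`, as `‖a‖ ≤ 1`, so the weight at `y` dominates the one at `x`.
  rcases (norm_nonneg x).eq_or_lt with hx0 | hx0
  · rcases k.eq_zero_or_pos with rfl | hk
    · have := Convex.norm_image_sub_le_of_norm_fderiv_le (𝕜 := ℝ) (f := iteratedFDeriv ℝ n f)
        (s := Set.univ) (C := M) (x := x) (y := x - a)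
        (fun y _ => (f.smooth (n + 1 : ℕ)).differentiable_iteratedFDeriv (by exact_mod_cast n.lt_succ_self) y)
        (fun y _ => by rw [norm_fderiv_iteratedFDeriv]; simpa using hb y) convex_univ
        (Set.mem_univ _) (Set.mem_univ _)
      simpa using this
    · rw [← hx0, zero_pow hk.ne', zero_mul]
      positivity
  · have := Convex.norm_image_sub_le_of_norm_fderiv_le (𝕜 := ℝ) (f := iteratedFDeriv ℝ n f)
      (s := Metric.closedBall x ‖a‖) (C := M / ‖x‖ ^ k) (x := x) (y := x - a)
      (fun y _ => (f.smooth (n + 1 : ℕ)).differentiable_iteratedFDeriv (by exact_mod_cast n.lt_succ_self) y)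
      (fun y hy => by
        rw [norm_fderiv_iteratedFDeriv, le_div_iff₀ (by positivity), mul_comm]
        refine le_trans ?_ (hb y)
        gcongr
        have h1 : ‖x‖ ≤ ‖y‖ + ‖y - x‖ := by
          have := norm_sub_le y (y - x)
          simpa using this
        have h2 : ‖y - x‖ ≤ ‖a‖ := by simpa [dist_eq_norm] using hy
        linarith) (convex_closedBall x ‖a‖) (Metric.mem_closedBall_self (norm_nonneg _))
      (by simp)
    calc _ ≤ ‖x‖ ^ k * (M / ‖x‖ ^ k * ‖(x - a) - x‖) := by gcongr
      _ = M * ‖a‖ := by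
        rw [sub_sub_cancel_left, norm_neg]
        field_simp

theorem continuous_compSubConstCLM (f : 𝓢(E, F)) :
    Continuous fun a : E => f.compSubConstCLM ℂ a := by
  have h0 : ∀ f : 𝓢(E, F), Tendsto (fun a : E => f.compSubConstCLM ℂ a) (𝓝 0) (𝓝 f) := by
    intro f
    rw [(schwartz_withSeminorms ℂ E F).tendsto_nhds]
    rintro ⟨k, n⟩ ε hε
    obtain ⟨C, hC, h⟩ := exists_seminorm_compSubConstCLM_sub_le f k n
    filter_upwards [Metric.ball_mem_nhds (0 : E) (show (0 : ℝ) < min 1 (ε / (C + 1)) by positivity)]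
      with a ha
    rw [mem_ball_zero_iff, lt_min_iff, lt_div_iff₀ (by positivity)] at ha
    refine (h a ha.1.le).trans_lt ?_
    nlinarith [norm_nonneg a]
  refine continuous_iff_continuousAt.2 fun a => ?_
  have h1 : Tendsto (fun c : E => c - a) (𝓝 a) (𝓝 0) :=
    (continuous_id.sub continuous_const).tendsto' a 0 (sub_self a)
  refine ((h0 (f.compSubConstCLM ℂ a)).comp h1).congr fun c => ?_
  ext x
  simp [SchwartzMap.compSubConstCLM_apply]

end Translation

/-! ### From finite double sums to double integrals -/

section Averaging

variable {X : Type*} [MeasurableSpace X]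

theorem MeasureTheory.MeasurePreserving.integral_comp_of_aestronglyMeasurable {Y E : Type*}
    [MeasurableSpace Y] [NormedAddCommGroup E] [NormedSpace ℝ E] {μ : Measure X} {ν : Measure Y}
    {f : X → Y} (hf : MeasurePreserving f μ ν) {u : Y → E} (hu : AEStronglyMeasurable u ν) :
    ∫ x, u (f x) ∂μ = ∫ y, u y ∂ν := by
  rw [← hf.map_eq] at hu ⊢
  exact (integral_map hf.measurable.aemeasurable hu).symm

theorem measurePreserving_eval_pair (ν : Measure X) [IsProbabilityMeasure ν] {N : ℕ} {i j : Fin N}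
    (hij : i ≠ j) : MeasurePreserving (fun s : Fin N → X => (s i, s j))
      (Measure.pi fun _ => ν) (ν.prod ν) := by
  have h := (ProbabilityTheory.iIndepFun_pi (μ := fun _ : Fin N => ν) (X := fun _ x => x)
    fun _ => aemeasurable_id).indepFun hij
  refine ⟨by fun_prop, ?_⟩
  rw [ProbabilityTheory.indepFun_iff_map_prod_eq_prod_map_map
    (measurable_pi_apply i).aemeasurable (measurable_pi_apply j).aemeasurable] at h
  rw [h]
  congr 1
  · exact (measurePreserving_eval (fun _ => ν) i).map_eq
  · exact (measurePreserving_eval (fun _ => ν) j).map_eq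

/-- A kernel all of whose finite double sums are nonnegative has nonnegative double integrals. -/
theorem integral_prod_nonneg_of_sum_nonneg (ν : Measure X) [IsProbabilityMeasure ν]
    {Q : X × X → ℂ} (hQ : Integrable Q (ν.prod ν)) (hd : Integrable (fun s => Q (s, s)) ν)
    (h : ∀ (N : ℕ) (s : Fin N → X), 0 ≤ ∑ i, ∑ j, Q (s i, s j)) :
    0 ≤ ∫ z, Q z ∂(ν.prod ν) := by
  set I := ∫ z, Q z ∂(ν.prod ν)
  set d := ∫ s, Q (s, s) ∂ν
  have hint : ∀ (N : ℕ) (i j : Fin N),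
      Integrable (fun s : Fin N → X => Q (s i, s j)) (Measure.pi fun _ => ν) ∧
        ∫ s : Fin N → X, Q (s i, s j) ∂(Measure.pi fun _ => ν) = if i = j then d else I := by
    intro N i j
    by_cases hij : i = j
    · subst hij
      have hm := measurePreserving_eval (fun _ : Fin N => ν) i
      refine ⟨hm.integrable_comp_of_integrable hd, ?_⟩
      rw [if_pos rfl]
      exact hm.integral_comp_of_aestronglyMeasurable hd.aestronglyMeasurable
    · have hm := measurePreserving_eval_pair ν hij
      refine ⟨hm.integrable_comp_of_integrable hQ, ?_⟩
      rw [if_neg hij]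
      exact hm.integral_comp_of_aestronglyMeasurable hQ.aestronglyMeasurable
  -- Average `N⁻² ∑ Q(s_i, s_j)` over `N = n + 1` independent points. The `N` diagonal terms
  -- contribute `d/N`, the `N n` pairs of distinct points contribute `I n/N`, and the diagonal
  -- disappears as `n → ∞`.
  have hN : ∀ n : ℕ, 0 ≤ d * ((n : ℝ) + 1 : ℝ)⁻¹ + I * (n / (n + 1 : ℝ) : ℝ) := by
    intro n
    have h1 : 0 ≤ ∫ s : Fin (n + 1) → X, ∑ i, ∑ j, Q (s i, s j) ∂(Measure.pi fun _ => ν) :=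
      integral_nonneg fun s => h (n + 1) s
    rw [integral_finsetSum _ fun i _ => integrable_finsetSum _ fun j _ => (hint _ i j).1] at h1
    simp only [integral_finsetSum _ fun j _ => (hint _ _ j).1, (hint _ _ _).2] at h1
    have h2 : ∀ i : Fin (n + 1), ∑ j, (if i = j then d else I) = d + n * I := by
      intro i
      rw [← Finset.add_sum_erase _ _ (Finset.mem_univ i), if_pos rfl,
        Finset.sum_congr rfl fun j hj => if_neg (Finset.ne_of_mem_erase hj).symm]
      simp
    simp only [h2, Finset.sum_const, Finset.card_univ, Fintype.card_fin, nsmul_eq_mul] at h1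
    have h3 : (0 : ℂ) ≤ ((((n : ℝ) + 1)⁻¹ ^ 2 : ℝ) : ℂ) := by
      rw [Complex.zero_le_real]
      positivity
    convert mul_nonneg h3 h1 using 1
    have h4 : (n : ℂ) + 1 ≠ 0 := by exact_mod_cast n.succ_ne_zero
    push_cast
    field_simp
  have hlim : Tendsto (fun n : ℕ => d * ((n : ℝ) + 1 : ℝ)⁻¹ + I * (n / (n + 1 : ℝ) : ℝ)) atTop
      (𝓝 (d * (0 : ℝ) + I * (1 : ℝ))) := by
    refine Tendsto.add (Tendsto.const_mul d ?_) (Tendsto.const_mul I ?_)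
    · have := tendsto_one_div_add_atTop_nhds_zero_nat (𝕜 := ℝ)
      simp only [one_div] at this
      have h := (Complex.continuous_ofReal.tendsto _).comp this
      simpa [Function.comp_def] using h
    · exact (Complex.continuous_ofReal.tendsto _).comp (tendsto_natCast_div_add_atTop 1)
  have := ge_of_tendsto' hlim hN
  simpa using this

end Averaging

/-! ### Functions of positive type -/

section PositiveDefiniteFunctions

/-- Over `ℂ` Hermiticity is automatic: a quadratic form with real values comes from a symmetric
operator. -/
theorem posSemidef_of_sum_nonneg {n : Type*} [Fintype n] {M : Matrix n n ℂ}
    (h : ∀ x : n → ℂ, 0 ≤ ∑ i, ∑ j, conj (x i) * x j * M i j) : M.PosSemidef := by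
  classical
  have hq : ∀ x : n → ℂ, 0 ≤ star x ⬝ᵥ M.mulVec x := by
    intro x
    convert h x using 1
    simp only [dotProduct, Matrix.mulVec, Finset.mul_sum, Pi.star_apply, RCLike.star_def]
    exact Finset.sum_congr rfl fun i _ => Finset.sum_congr rfl fun j _ => by ring
  refine .of_dotProduct_mulVec_nonneg ?_ hq
  have hself : LinearMap.IsSymmetric (Matrix.toEuclideanLin M) := by
    rw [LinearMap.isSymmetric_iff_inner_map_self_real]
    intro v
    have h1 : ⟪v, Matrix.toEuclideanLin M v⟫_ℂ = star (v.ofLp) ⬝ᵥ M.mulVec v.ofLp := by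
      simp [PiLp.inner_apply, dotProduct, mul_comm, Matrix.toLpLin_apply]
    have h2 := (hq v.ofLp)
    rw [← h1] at h2
    rw [inner_conj_symm, ← inner_conj_symm (Matrix.toEuclideanLin M v) v]
    exact (Complex.conj_eq_iff_im.2 (Complex.nonneg_iff.1 h2).2.symm).symm
  exact Matrix.isSymmetric_toEuclideanLin_iff.1 hself

theorem Matrix.PosSemidef.sum_nonneg {n : Type*} [Fintype n] {M : Matrix n n ℂ} (h : M.PosSemidef)
    (x : n → ℂ) : 0 ≤ ∑ i, ∑ j, conj (x i) * x j * M i j := by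
  convert h.dotProduct_mulVec_nonneg x using 1
  simp only [dotProduct, Matrix.mulVec, Finset.mul_sum, Pi.star_apply, RCLike.star_def]
  exact Finset.sum_congr rfl fun i _ => Finset.sum_congr rfl fun j _ => by ring

variable {ι : Type*} [Fintype ι]

/-- Matrix-valued functions of positive type on the line. -/
def IsPosDefMatrixFun (h : ι → ι → ℝ → ℂ) : Prop :=
  ∀ (m : ℕ) (s : Fin m → ℝ) (v : Fin m → ι → ℂ),
    0 ≤ ∑ i, ∑ j, ∑ α, ∑ β, conj (v i α) * v j β * h α β (s j - s i)

/-- Complex functions of positive type on the line. -/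
def IsPosDefFun (p : ℝ → ℂ) : Prop :=
  ∀ (m : ℕ) (s : Fin m → ℝ), (Matrix.of fun i j => p (s j - s i)).PosSemidef

/-- The two points `0, u` with components `α, β` give a positive `2 × 2` matrix; its determinant
bounds `|h_{αβ}(u)|²` by `h_{αα}(0) h_{ββ}(0)`. -/
theorem IsPosDefMatrixFun.exists_bound {h : ι → ι → ℝ → ℂ} (hh : IsPosDefMatrixFun h) :
    ∃ M : ℝ, 0 ≤ M ∧ ∀ α β u, ‖h α β u‖ ≤ M := by
  classical
  have hM : ∀ α, ‖h α α 0‖ ≤ ∑ α, ‖h α α 0‖ := fun α =>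
    Finset.single_le_sum (f := fun α => ‖h α α 0‖) (fun _ _ => norm_nonneg _) (Finset.mem_univ α)
  refine ⟨∑ α, ‖h α α 0‖, by positivity, fun α β u => ?_⟩
  let e : Fin 2 → ι := ![α, β]
  let s : Fin 2 → ℝ := ![0, u]
  have hK : (Matrix.of fun i j => h (e i) (e j) (s j - s i)).PosSemidef := by
    refine posSemidef_of_sum_nonneg fun x => ?_
    convert hh 2 s (fun i γ => if γ = e i then x i else 0) using 4 with i _ j _
    rw [Finset.sum_eq_single (e i), Finset.sum_eq_single (e j)]
    · simp
    · intro γ _ hγ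
      simp [hγ]
    · simp
    · intro γ _ hγ
      simp [hγ]
    · simp
  have hdet := hK.det_nonneg
  rw [Matrix.det_fin_two] at hdet
  have h10 := hK.isHermitian.apply 1 0
  rw [← h10] at hdet
  simp only [Matrix.of_apply, e, s, Matrix.cons_val_zero, Matrix.cons_val_one, sub_self, sub_zero,
    RCLike.star_def, Complex.mul_conj, Complex.normSq_eq_norm_sq] at hdet
  have hre : ‖h α β u‖ ^ 2 ≤ (h α α 0 * h β β 0).re := by
    have := (Complex.nonneg_iff.1 hdet).1
    rw [Complex.sub_re, Complex.ofReal_re] at this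
    linarith
  refine abs_le_of_sq_le_sq' (b := ∑ α, ‖h α α 0‖) ?_ (by positivity) |>.2
  calc ‖h α β u‖ ^ 2 ≤ ‖h α α 0 * h β β 0‖ := hre.trans (Complex.re_le_norm _)
    _ = ‖h α α 0‖ * ‖h β β 0‖ := norm_mul _ _
    _ ≤ _ := by
      rw [sq]
      exact mul_le_mul (hM α) (hM β) (norm_nonneg _) (by positivity)

/-- The Schur product of functions of positive type. -/
theorem IsPosDefMatrixFun.mul {h : ι → ι → ℝ → ℂ} (hh : IsPosDefMatrixFun h) {p : ℝ → ℂ}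
    (hp : IsPosDefFun p) : IsPosDefMatrixFun fun α β u => p u * h α β u := by
  intro m s v
  obtain ⟨X, hX⟩ := exists_conjTranspose_mul_self_of_posSemidef (hp m s)
  have hX' : ∀ i j, p (s j - s i) = ∑ k, conj (X k i) * X k j := by
    intro i j
    have := congrFun (congrFun hX i) j
    simpa [Matrix.mul_apply] using this
  -- The Gram factors of `p` are absorbed into the test vectors, one positive form for each `k`.
  have : ∑ i, ∑ j, ∑ α, ∑ β, conj (v i α) * v j β * (p (s j - s i) * h α β (s j - s i)) =
      ∑ k, ∑ i, ∑ j, ∑ α, ∑ β, conj (X k i * v i α) * (X k j * v j β) * h α β (s j - s i) := by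
    rw [Finset.sum_comm]
    simp only [hX', Finset.sum_mul, Finset.mul_sum]
    rw [Finset.sum_comm]
    have hswap : ∀ f : Fin m → Fin m → ι → ι → Fin m → ℂ,
        ∑ i, ∑ j, ∑ α, ∑ β, ∑ k, f i j α β k = ∑ k, ∑ i, ∑ j, ∑ α, ∑ β, f i j α β k := by
      intro f
      simp only [Finset.sum_comm (s := (Finset.univ : Finset ι)) (t := (Finset.univ : Finset (Fin m)))]
      rw [Finset.sum_congr rfl fun i _ => Finset.sum_comm, Finset.sum_comm]
    rw [hswap]
    refine Finset.sum_congr rfl fun k _ => Finset.sum_congr rfl fun i _ =>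
      Finset.sum_congr rfl fun j _ => Finset.sum_congr rfl fun α _ => Finset.sum_congr rfl fun β _ => ?_
    rw [map_mul]
    ring
  rw [this]
  exact Finset.sum_nonneg fun k _ => hh m s fun i α => X k i * v i α

theorem IsPosDefMatrixFun.contract {h : ι → ι → ℝ → ℂ} (hh : IsPosDefMatrixFun h) (c : ι → ℂ) :
    IsPosDefMatrixFun fun _ _ : Unit => fun u => ∑ α, ∑ β, conj (c α) * c β * h α β u := by
  intro m s v
  convert hh m s fun i α => v i () * c α using 4 with i _ j _
  simp only [Finset.univ_unique, Finset.sum_singleton, Finset.mul_sum]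
  refine Finset.sum_congr rfl fun α _ => Finset.sum_congr rfl fun β _ => ?_
  rw [map_mul]
  ring

theorem IsPosDefMatrixFun.comp_mul_left {h : ι → ι → ℝ → ℂ} (hh : IsPosDefMatrixFun h) (r : ℝ) :
    IsPosDefMatrixFun fun α β u => h α β (r * u) := by
  intro m s v
  simpa only [mul_sub] using hh m (fun i => r * s i) v

theorem IsPositiveTypeFun.isPosDefFun {w : ℝ → ℝ} (hw : IsPositiveTypeFun w) :
    IsPosDefFun fun u => (w u : ℂ) := hw

/-- The easy half of Bochner's theorem: the quadratic form is `∫ |∑ x_i e^{-iωs_i}|² h(ω) dω`. -/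
theorem isPosDefFun_angularFourier {h : 𝓢(ℝ, ℂ)} (hh : ∀ ω, 0 ≤ h ω) :
    IsPosDefFun (angularFourier h) := by
  intro m s
  refine posSemidef_of_sum_nonneg fun x => ?_
  let e : ℝ → ℝ → ℂ := fun ω u => Complex.exp (-(Complex.I * ω * u))
  have he : ∀ ω u, ‖e ω u‖ = 1 := by
    intro ω u
    have : -(Complex.I * ω * u) = ((-(ω * u) : ℝ) : ℂ) * Complex.I := by push_cast; ring
    simp only [e]
    rw [this, Complex.norm_exp_ofReal_mul_I]
  have hi : ∀ u, Integrable fun ω : ℝ => e ω u * h ω := by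
    intro u
    refine h.integrable.bdd_mul (c := 1) ?_ (ae_of_all _ fun ω => (he ω u).le)
    exact Continuous.aestronglyMeasurable (by fun_prop)
  have hconj : ∀ ω u u', conj (e ω u) * e ω u' = e ω (u' - u) := by
    intro ω u u'
    simp only [e]
    rw [← Complex.exp_conj, ← Complex.exp_add]
    congr 1
    simp
    ring
  have h1 : ∑ i, ∑ j, conj (x i) * x j * (Matrix.of fun i j => angularFourier h (s j - s i)) i j =
      ∫ ω : ℝ, ∑ i, ∑ j, conj (x i) * x j * (e ω (s j - s i) * h ω) := by
    rw [integral_finsetSum _ fun i _ => integrable_finsetSum _ fun j _ => (hi _).const_mul _]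
    refine Finset.sum_congr rfl fun i _ => ?_
    rw [integral_finsetSum _ fun j _ => (hi _).const_mul _]
    refine Finset.sum_congr rfl fun j _ => ?_
    rw [integral_const_mul, Matrix.of_apply, angularFourier_apply]
  rw [h1]
  refine integral_nonneg fun ω => ?_
  have h2 : ∑ i, ∑ j, conj (x i) * x j * (e ω (s j - s i) * h ω) =
      (conj (∑ i, x i * e ω (s i)) * ∑ i, x i * e ω (s i)) * h ω := by
    rw [map_sum, Finset.sum_mul_sum, Finset.sum_mul]
    refine Finset.sum_congr rfl fun i _ => ?_
    rw [Finset.sum_mul]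
    refine Finset.sum_congr rfl fun j _ => ?_
    rw [← hconj, map_mul]
    ring
  simp only [Pi.zero_apply]
  rw [h2]
  exact mul_nonneg (star_mul_self_nonneg _) (hh ω)

end PositiveDefiniteFunctions

/-! ### Integrals of functions of positive type -/

section PositiveIntegrals

open ProbabilityTheory

theorem continuous_cauchyPDFReal_zero_one : Continuous (cauchyPDFReal 0 1) := by
  have h : cauchyPDFReal 0 1 = fun x : ℝ => Real.pi⁻¹ * (x ^ 2 + 1)⁻¹ := by
    ext x
    simp [cauchyPDFReal_def]
  rw [h]
  exact continuous_const.mul ((by fun_prop : Continuous fun x : ℝ => x ^ 2 + 1).inv₀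
    fun x => by positivity)

theorem integral_cauchyMeasure_zero_one {f : ℝ → ℂ} :
    ∫ x, f x ∂(cauchyMeasure 0 1) = ∫ x, (cauchyPDFReal 0 1 x : ℂ) * f x := by
  rw [cauchyMeasure_of_scale_ne_zero 0 one_ne_zero, integral_withDensity_eq_integral_toReal_smul
    (measurable_cauchyPDF 0 1) (ae_of_all _ fun x => by simp [cauchyPDF])]
  refine integral_congr_ae (ae_of_all _ fun x => ?_)
  simp only [cauchyPDF, ENNReal.toReal_ofReal (cauchyPDF_pos 0 one_ne_zero x).le,
    Complex.real_smul]

theorem SchwartzMap.exists_norm_le_mul_cauchyPDFReal (ψ : 𝓢(ℝ, ℂ)) :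
    ∃ C : ℝ, ∀ x, ‖ψ x‖ ≤ C * cauchyPDFReal 0 1 x := by
  refine ⟨Real.pi * (SchwartzMap.seminorm ℝ 2 0 ψ + SchwartzMap.seminorm ℝ 0 0 ψ), fun x => ?_⟩
  have h2 := SchwartzMap.norm_pow_mul_le_seminorm ℝ ψ 2 x
  have h0 := SchwartzMap.norm_le_seminorm ℝ ψ x
  have hp : cauchyPDFReal 0 1 x = Real.pi⁻¹ * (x ^ 2 + 1)⁻¹ := by
    simp [cauchyPDFReal_def]
  rw [hp]
  have : ‖ψ x‖ * (x ^ 2 + 1) ≤ SchwartzMap.seminorm ℝ 2 0 ψ + SchwartzMap.seminorm ℝ 0 0 ψ := by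
    rw [Real.norm_eq_abs, sq_abs] at h2
    linarith
  have hpi := Real.pi_pos
  rw [← le_div_iff₀ (by positivity)] at this
  refine this.trans (le_of_eq ?_)
  field_simp

theorem integrable_correlation_kernel (ψ φ : 𝓢(ℝ, ℂ)) {f : ℝ → ℂ} (hf : Continuous f) {M : ℝ}
    (hM : ∀ u, ‖f u‖ ≤ M) :
    Integrable (fun z : ℝ × ℝ => conj (ψ z.1) * φ (z.1 + z.2) * f z.2) (volume.prod volume) := by
  have h1 : Integrable (fun z : ℝ × ℝ => conj (ψ z.1) * φ z.2) (volume.prod volume) :=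
    (schwartzConj ψ).integrable.mul_prod φ.integrable
  have h2 := (measurePreserving_prod_add (volume : Measure ℝ) (volume : Measure ℝ))
  have h3 := h2.integrable_comp_of_integrable h1
  exact h3.mul_bdd (c := M) (hf.comp continuous_snd).aestronglyMeasurable
    (ae_of_all _ fun z => hM z.2)

theorem integral_integral_sub_eq_integral_correlation (ψ φ : 𝓢(ℝ, ℂ)) {f : ℝ → ℂ}
    (hf : Continuous f) {M : ℝ} (hM : ∀ u, ‖f u‖ ≤ M) :
    ∫ s, ∫ t, conj (ψ s) * φ t * f (t - s) = ∫ u, correlation ψ φ u * f u := by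
  have h1 : ∀ s, ∫ t, conj (ψ s) * φ t * f (t - s) = ∫ u, conj (ψ s) * φ (s + u) * f u := by
    intro s
    rw [← integral_add_left_eq_self (fun t => conj (ψ s) * φ t * f (t - s)) s]
    simp
  simp only [h1]
  rw [integral_integral_swap (integrable_correlation_kernel ψ φ hf hM)]
  refine integral_congr_ae (ae_of_all _ fun u => ?_)
  simp only [correlation_apply]
  exact integral_mul_const _ _

variable {ι : Type*} [Fintype ι]

/-- The averaging argument needs a probability measure. The Cauchy law serves because its density
`p` decays slowly enough for `ψ/p` to be bounded, so that the kernel is bounded and integrable also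
on the diagonal. -/
theorem IsPosDefMatrixFun.integral_correlation_nonneg {h : ι → ι → ℝ → ℂ}
    (hh : IsPosDefMatrixFun h) (hc : ∀ α β, Continuous (h α β)) (ψ : ι → 𝓢(ℝ, ℂ)) :
    0 ≤ ∑ α, ∑ β, ∫ u, correlation (ψ α) (ψ β) u * h α β u := by
  obtain ⟨M, hM0, hM⟩ := hh.exists_bound
  set ν := cauchyMeasure 0 1
  set p := cauchyPDFReal 0 1
  have hp0 : ∀ x, 0 < p x := cauchyPDF_pos 0 one_ne_zero
  have hpc : Continuous p := continuous_cauchyPDFReal_zero_one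
  let v : ι → ℝ → ℂ := fun α s => ((p s)⁻¹ : ℝ) * ψ α s
  have hvc : ∀ α, Continuous (v α) := fun α =>
    (Complex.continuous_ofReal.comp (hpc.inv₀ fun x => (hp0 x).ne')).mul (ψ α).continuous
  have hvb : ∀ α, ∃ C, ∀ s, ‖v α s‖ ≤ C := by
    intro α
    obtain ⟨C, hC⟩ := (ψ α).exists_norm_le_mul_cauchyPDFReal
    refine ⟨C, fun s => ?_⟩
    rw [norm_mul, Complex.norm_real, Real.norm_of_nonneg (inv_pos.2 (hp0 s)).le,
      inv_mul_le_iff₀ (hp0 s), mul_comm]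
    exact hC s
  have hpv : ∀ α s, (p s : ℂ) * v α s = ψ α s := by
    intro α s
    have : (p s : ℂ) ≠ 0 := by exact_mod_cast (hp0 s).ne'
    simp only [v]
    push_cast
    field_simp
  have hpv' : ∀ α s, (p s : ℂ) * conj (v α s) = conj (ψ α s) := by
    intro α s
    have := congrArg conj (hpv α s)
    rwa [map_mul, Complex.conj_ofReal] at this
  let q : ι → ι → ℝ × ℝ → ℂ := fun α β z => conj (v α z.1) * v β z.2 * h α β (z.2 - z.1)
  have hqc : ∀ α β, Continuous (q α β) := fun α β =>
    ((Complex.continuous_conj.comp ((hvc α).comp continuous_fst)).mul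
      ((hvc β).comp continuous_snd)).mul ((hc α β).comp (continuous_snd.sub continuous_fst))
  have hqb : ∀ α β, ∃ C, ∀ z, ‖q α β z‖ ≤ C := by
    intro α β
    obtain ⟨C, hC⟩ := hvb α
    obtain ⟨D, hD⟩ := hvb β
    refine ⟨C * D * M, fun z => ?_⟩
    rw [norm_mul, norm_mul, RCLike.norm_conj]
    have hC0 : 0 ≤ C := (norm_nonneg _).trans (hC 0)
    have hD0 : 0 ≤ D := (norm_nonneg _).trans (hD 0)
    gcongr
    exacts [hC _, hD _, hM _ _ _]
  have hqi : ∀ α β, Integrable (q α β) (ν.prod ν) := by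
    intro α β
    obtain ⟨C, hC⟩ := hqb α β
    exact .of_bound (hqc α β).aestronglyMeasurable C (ae_of_all _ hC)
  have hdi : ∀ α β, Integrable (fun s => q α β (s, s)) ν := by
    intro α β
    obtain ⟨C, hC⟩ := hqb α β
    exact .of_bound ((hqc α β).comp (continuous_id.prodMk continuous_id)).aestronglyMeasurable C
      (ae_of_all _ fun s => hC (s, s))
  have hint : ∀ α β, ∫ z, q α β z ∂(ν.prod ν) = ∫ u, correlation (ψ α) (ψ β) u * h α β u := by
    intro α β
    rw [← integral_integral_sub_eq_integral_correlation _ _ (hc α β) (hM α β),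
      integral_prod _ (hqi α β), integral_cauchyMeasure_zero_one]
    refine integral_congr_ae (ae_of_all _ fun s => ?_)
    simp only [ν]
    rw [integral_cauchyMeasure_zero_one, ← integral_const_mul]
    refine integral_congr_ae (ae_of_all _ fun t => ?_)
    simp only [q]
    rw [← hpv', ← hpv]
    ring
  have key := integral_prod_nonneg_of_sum_nonneg ν (Q := fun z => ∑ α, ∑ β, q α β z)
    (integrable_finsetSum _ fun α _ => integrable_finsetSum _ fun β _ => hqi α β)
    (integrable_finsetSum _ fun α _ => integrable_finsetSum _ fun β _ => hdi α β)
    fun N s => hh N s fun i α => v α (s i)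
  rw [integral_finsetSum _ fun α _ => integrable_finsetSum _ fun β _ => hqi α β] at key
  simpa only [integral_finsetSum _ fun β _ => hqi _ β, hint] using key

theorem correlation_self_zero_pos {χ : 𝓢(ℝ, ℂ)} (hχ : χ ≠ 0) : 0 < correlation χ χ 0 := by
  have h1 : correlation χ χ 0 = ((∫ s, ‖χ s‖ ^ 2 : ℝ) : ℂ) := by
    rw [correlation_apply, ← integral_complex_ofReal]
    refine integral_congr_ae (ae_of_all _ fun s => ?_)
    simp only [add_zero]
    rw [← Complex.normSq_eq_conj_mul_self, Complex.normSq_eq_norm_sq]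
  rw [h1, Complex.zero_lt_real]
  obtain ⟨x, hx⟩ : ∃ x, χ x ≠ 0 := by
    by_contra! h0
    exact hχ (SchwartzMap.ext h0)
  have hi : Integrable fun s => ‖χ s‖ ^ 2 := by
    simpa using (χ.memLp 2 volume).integrable_norm_pow (by norm_num)
  exact integral_pos_of_integrable_nonneg_nonzero (x := x) (χ.continuous.norm.pow 2) hi
    (fun s => pow_nonneg (norm_nonneg _) 2) (pow_ne_zero 2 (norm_ne_zero_iff.2 hx))

theorem exists_schwartzMap_ne_zero : ∃ χ : 𝓢(ℝ, ℂ), χ ≠ 0 := by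
  let φ : ContDiffBump (0 : ℝ) := ⟨1, 2, one_pos, one_lt_two⟩
  have h1 : ContDiff ℝ (⊤ : ℕ∞) fun x => (φ x : ℂ) :=
    Complex.ofRealCLM.contDiff.comp φ.contDiff
  have h2 : HasCompactSupport fun x => (φ x : ℂ) := 
    φ.hasCompactSupport.comp_left (g := Complex.ofReal) Complex.ofReal_zero
  refine ⟨h2.toSchwartzMap h1, fun h => ?_⟩
  have h3 := congrArg (fun χ : 𝓢(ℝ, ℂ) => χ 0) h
  have h4 : φ 0 = 1 := φ.one_of_mem_closedBall (Metric.mem_closedBall_self φ.rIn_pos.le)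
  have h5 : h2.toSchwartzMap h1 0 = 1 := by
    refine (h2.toSchwartzMap_toFun h1 0).trans ?_
    simp [h4]
  rw [h5] at h3
  exact one_ne_zero h3

/-- An integrable continuous function of positive type has nonnegative integral. -/
theorem IsPosDefMatrixFun.integral_nonneg {f : ℝ → ℂ} (hf : IsPosDefMatrixFun fun _ _ : Unit => f)
    (hc : Continuous f) (hi : Integrable f) : 0 ≤ ∫ u, f u := by
  obtain ⟨χ, hχ⟩ := exists_schwartzMap_ne_zero
  set A := correlation χ χ
  have hA := correlation_self_zero_pos hχ
  have hn : ∀ n : ℕ, 0 ≤ ∫ u, A (((n : ℝ) + 1)⁻¹ * u) * f u := by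
    intro n
    -- Dilating `f` and substituting back spreads the autocorrelation `A` out, so that it tends to
    -- the constant `A 0 > 0`.
    have h1 := (hf.comp_mul_left ((n : ℝ) + 1)).integral_correlation_nonneg
      (fun _ _ => hc.comp (continuous_const.mul continuous_id)) fun _ => χ
    simp only [Finset.univ_unique, Finset.sum_singleton] at h1
    have h2 := Measure.integral_comp_mul_left (fun u => A (((n : ℝ) + 1)⁻¹ * u) * f u) ((n : ℝ) + 1)
    have h0 : (n : ℝ) + 1 ≠ 0 := by positivity
    simp only [inv_mul_cancel_left₀ h0] at h2
    rw [h2, abs_of_pos (by positivity), Complex.real_smul] at h1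
    have h3 : (0 : ℂ) ≤ ((n + 1 : ℝ) : ℂ) := Complex.zero_le_real.2 (by positivity)
    have h4 := mul_nonneg h3 h1
    rwa [← mul_assoc, ← Complex.ofReal_mul, mul_inv_cancel₀ h0, Complex.ofReal_one, one_mul] at h4
  have hlim : Tendsto (fun n : ℕ => ∫ u, A (((n : ℝ) + 1)⁻¹ * u) * f u) atTop
      (𝓝 (∫ u, A 0 * f u)) := by
    refine tendsto_integral_of_dominated_convergence
      (fun u => SchwartzMap.seminorm ℝ 0 0 A * ‖f u‖) (fun n => ?_) (hi.norm.const_mul _)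
      (fun n => ae_of_all _ fun u => ?_) (ae_of_all _ fun u => ?_)
    · exact Continuous.aestronglyMeasurable (by fun_prop)
    · rw [norm_mul]
      gcongr
      exact A.norm_le_seminorm ℝ _
    · refine Tendsto.mul_const _ ((A.continuous.tendsto 0).comp ?_)
      have h1 := tendsto_one_div_add_atTop_nhds_zero_nat (𝕜 := ℝ)
      simpa [one_div] using h1.mul_const u
  have h1 := ge_of_tendsto' hlim hn
  rw [integral_const_mul] at h1
  have h2 := mul_nonneg (inv_nonneg.2 hA.le) h1
  rwa [inv_mul_cancel_left₀ hA.ne'] at h2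

end PositiveIntegrals

/-! ### Exchanging tempered distributions with integrals -/

section WeakIntegral

theorem SchwartzMap.derivCLM_pow_apply (n : ℕ) (χ : 𝓢(ℝ, ℂ)) (x : ℝ) :
    ((SchwartzMap.derivCLM ℂ ℂ) ^ n) χ x = iteratedDeriv n χ x := by
  induction n generalizing χ with
  | zero => simp
  | succ n ih =>
    rw [pow_succ, mul_apply_eq_comp, ih, iteratedDeriv_succ']
    rfl

/-- The map `χ ↦ x^k χ^{(n)}(x)` into the bounded continuous functions. -/
def weightedDeriv (m : ℕ × ℕ) : 𝓢(ℝ, ℂ) →L[ℂ] BoundedContinuousFunction ℝ ℂ :=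
  (SchwartzMap.toBoundedContinuousFunctionCLM ℂ ℝ ℂ).comp
    ((SchwartzMap.smulLeftCLM ℂ fun x : ℝ => (x : ℂ) ^ m.1).comp
      ((SchwartzMap.derivCLM ℂ ℂ) ^ m.2))

theorem weightedDeriv_apply (m : ℕ × ℕ) (χ : 𝓢(ℝ, ℂ)) (x : ℝ) :
    weightedDeriv m χ x = (x : ℂ) ^ m.1 * iteratedDeriv m.2 χ x := by
  have h : Function.HasTemperateGrowth fun x : ℝ => (x : ℂ) ^ m.1 :=
    Function.HasTemperateGrowth.pow Function.Complex.hasTemperateGrowth_ofReal m.1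
  simp only [weightedDeriv, ContinuousLinearMap.comp_apply,
    SchwartzMap.toBoundedContinuousFunctionCLM_apply, SchwartzMap.smulLeftCLM_apply_apply h,
    SchwartzMap.derivCLM_pow_apply, smul_eq_mul]

theorem seminorm_le_norm_weightedDeriv (m : ℕ × ℕ) (χ : 𝓢(ℝ, ℂ)) :
    SchwartzMap.seminorm ℂ m.1 m.2 χ ≤ ‖weightedDeriv m χ‖ := by
  refine SchwartzMap.seminorm_le_bound' ℂ _ _ _ (norm_nonneg _) fun x => ?_
  have := (weightedDeriv m χ).norm_coe_le_norm x
  rw [weightedDeriv_apply, norm_mul, norm_pow, Complex.norm_real, Real.norm_eq_abs] at this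
  exact this

/-- A continuous functional on the Schwartz space factors through finitely many of the maps
`weightedDeriv`. -/
theorem exists_factor_weightedDeriv (T : 𝓢(ℝ, ℂ) →L[ℂ] ℂ) :
    ∃ (s : Finset (ℕ × ℕ)) (L : (s → BoundedContinuousFunction ℝ ℂ) →L[ℂ] ℂ),
      ∀ χ, T χ = L fun m => weightedDeriv m χ := by
  obtain ⟨s, C, -, hC⟩ := Seminorm.bound_of_continuous (schwartz_withSeminorms ℂ ℝ ℂ)
    ((normSeminorm ℂ ℂ).comp T.toLinearMap) (by
      change Continuous fun χ => ‖T χ‖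
      exact T.continuous.norm)
  let J : 𝓢(ℝ, ℂ) →ₗ[ℂ] (s → BoundedContinuousFunction ℝ ℂ) :=
    LinearMap.pi fun m => (weightedDeriv m).toLinearMap
  have hJ : ∀ χ, ‖T χ‖ ≤ C * ‖J χ‖ := by
    intro χ
    have h1 : ‖T χ‖ ≤ C * (s.sup (schwartzSeminormFamily ℂ ℝ ℂ)) χ := hC χ
    refine h1.trans ?_
    gcongr
    refine Seminorm.finset_sup_apply_le (norm_nonneg _) fun m hm => ?_
    exact (seminorm_le_norm_weightedDeriv m χ).trans (norm_le_pi_norm (J χ) ⟨m, hm⟩)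
  obtain ⟨r, hr⟩ := J.rangeRestrict.exists_rightInverse_of_surjective J.range_rangeRestrict
  have hr' : ∀ y, J (r y) = y := fun y => congrArg Subtype.val (LinearMap.congr_fun hr y)
  -- The section `r` is merely linear, but `|T χ| ≤ C ‖J χ‖` makes `T ∘ r` bounded on the range of
  -- `J`; Hahn–Banach extends it.
  let f : StrongDual ℂ (LinearMap.range J) :=
    (T.toLinearMap.comp r).mkContinuous C fun y => by
      refine (hJ (r y)).trans (le_of_eq ?_)
      rw [hr' y]
      rfl
  obtain ⟨L, hL, -⟩ := exists_extension_norm_eq _ f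
  refine ⟨s, L, fun χ => ?_⟩
  have h1 : L (J χ) = T (r ⟨J χ, χ, rfl⟩) := hL ⟨J χ, χ, rfl⟩
  have h2 : T (χ - r ⟨J χ, χ, rfl⟩) = 0 := by
    have := hJ (χ - r ⟨J χ, χ, rfl⟩)
    rw [map_sub J, hr', sub_self, norm_zero, mul_zero] at this
    exact norm_le_zero_iff.1 this
  rw [map_sub, sub_eq_zero] at h2
  rw [h2, ← h1]
  rfl

/-- Integrals of Schwartz functions commute with continuous functionals. -/
theorem ContinuousLinearMap.apply_eq_integral_of_iteratedDeriv (T : 𝓢(ℝ, ℂ) →L[ℂ] ℂ)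
    {Φ : ℝ → 𝓢(ℝ, ℂ)} (hΦ : Continuous Φ) {h : ℝ → ℂ} (hc : Continuous h)
    (hs : HasCompactSupport h) {Ψ : 𝓢(ℝ, ℂ)}
    (hΨ : ∀ n x, iteratedDeriv n Ψ x = ∫ ω, h ω * iteratedDeriv n (Φ ω) x) :
    T Ψ = ∫ ω, h ω * T (Φ ω) := by
  obtain ⟨s, L, hL⟩ := exists_factor_weightedDeriv T
  -- The Bochner integral is taken in this Banach space instead of the Schwartz space, and is
  -- identified by point evaluations.
  let J : ℝ → s → BoundedContinuousFunction ℝ ℂ := fun ω m => weightedDeriv m (Φ ω)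
  have hJc : Continuous J := continuous_pi fun m => (weightedDeriv m).continuous.comp hΦ
  have hi : Integrable fun ω => h ω • J ω :=
    (hc.smul hJc).integrable_of_hasCompactSupport hs.smul_right
  have hJ : (fun m : s => weightedDeriv m Ψ) = ∫ ω, h ω • J ω := by
    funext m
    ext x
    let ev : (s → BoundedContinuousFunction ℝ ℂ) →L[ℂ] ℂ :=
      (BoundedContinuousFunction.evalCLM ℂ x).comp (ContinuousLinearMap.proj m)
    have h1 : (∫ ω, h ω • J ω) m x = ∫ ω, ev (h ω • J ω) := (ev.integral_comp_comm hi).symm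
    rw [h1, weightedDeriv_apply, hΨ, ← integral_const_mul]
    refine integral_congr_ae (ae_of_all _ fun ω => ?_)
    have h2 : ev (h ω • J ω) = h ω * weightedDeriv m (Φ ω) x := rfl
    simp only [h2, weightedDeriv_apply]
    ring
  rw [hL, hJ, ← L.integral_comp_comm hi]
  refine integral_congr_ae (ae_of_all _ fun ω => ?_)
  simp only [map_smul, smul_eq_mul, hL]
  rfl

end WeakIntegral

/-! ### Modulated test functions and the frequency integral -/

section Modulation

/-- The character `s ↦ e^{-iωs}`. -/
def modulation (ω s : ℝ) : ℂ := Complex.exp (-(Complex.I * ω * s))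

theorem norm_modulation (ω s : ℝ) : ‖modulation ω s‖ = 1 := by
  have : -(Complex.I * ω * s) = ((-(ω * s) : ℝ) : ℂ) * Complex.I := by push_cast; ring
  rw [modulation, this, Complex.norm_exp_ofReal_mul_I]

theorem hasTemperateGrowth_modulation (ω : ℝ) : Function.HasTemperateGrowth (modulation ω) := by
  have hd : ∀ n, iteratedDeriv n (modulation ω) =
      fun s => (-(Complex.I * ω)) ^ n * modulation ω s := by
    intro n
    induction n with
    | zero => simp
    | succ n ih =>
      rw [iteratedDeriv_succ, ih]
      funext s
      have h1 : HasDerivAt (fun s : ℝ => -(Complex.I * ω * s)) (-(Complex.I * ω)) s := by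
        simpa using ((hasDerivAt_id s).ofReal_comp.const_mul (Complex.I * ω)).fun_neg
      have h2 := (h1.cexp.const_mul ((-(Complex.I * ω)) ^ n)).deriv
      refine Eq.trans h2 ?_
      rw [modulation]
      ring
  refine ⟨?_, fun n => ⟨0, ‖(-(Complex.I * ω)) ^ n‖, fun s => ?_⟩⟩
  · unfold modulation
    have : ContDiff ℝ (⊤ : ℕ∞) fun s : ℝ => (s : ℂ) := Complex.ofRealCLM.contDiff
    exact (contDiff_const.mul this).neg.cexp
  · rw [norm_iteratedFDeriv_eq_norm_iteratedDeriv, hd, norm_mul, norm_modulation]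
    simp

theorem fourier_smulLeftCLM_modulation (ω : ℝ) (W : 𝓢(ℝ, ℂ)) :
    𝓕 (SchwartzMap.smulLeftCLM ℂ (modulation ω) W) =
      (𝓕 W).compSubConstCLM ℂ (-(ω / (2 * Real.pi))) := by
  ext x
  rw [SchwartzMap.compSubConstCLM_apply, SchwartzMap.fourier_coe, SchwartzMap.fourier_coe,
    Real.fourier_real_eq, Real.fourier_real_eq]
  refine integral_congr_ae (ae_of_all _ fun s => ?_)
  simp only [SchwartzMap.smulLeftCLM_apply_apply (hasTemperateGrowth_modulation ω), Circle.smul_def,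
    Real.fourierChar_apply, smul_eq_mul, modulation]
  rw [← mul_assoc, ← Complex.exp_add]
  congr 2
  have : (Real.pi : ℂ) ≠ 0 := by exact_mod_cast Real.pi_ne_zero
  push_cast
  field_simp
  ring

/-- Modulation becomes translation under the Fourier transform, where continuity is already known.
-/
theorem continuous_smulLeftCLM_modulation (W : 𝓢(ℝ, ℂ)) :
    Continuous fun ω => SchwartzMap.smulLeftCLM ℂ (modulation ω) W := by
  have h : ∀ ω, SchwartzMap.smulLeftCLM ℂ (modulation ω) W =
      𝓕⁻ ((𝓕 W).compSubConstCLM ℂ (-(ω / (2 * Real.pi)))) := by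
    intro ω
    rw [← fourier_smulLeftCLM_modulation, FourierTransform.fourierInv_fourier_eq]
  simp only [h]
  exact (FourierTransform.fourierInvCLM ℂ 𝓢(ℝ, ℂ)).continuous.comp
    ((continuous_compSubConstCLM (𝓕 W)).comp (by fun_prop))

theorem iteratedDeriv_fourier_apply (V : 𝓢(ℝ, ℂ)) (n : ℕ) (x : ℝ) :
    iteratedDeriv n (𝓕 V : 𝓢(ℝ, ℂ)) x =
      ∫ s : ℝ, modulation (2 * Real.pi * x) s * ((-2 * Real.pi * Complex.I * s) ^ n * V s) := by
  have hi : ∀ m : ℕ, (m : ℕ∞) ≤ ⊤ → Integrable fun s : ℝ => s ^ m • V s := by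
    intro m _
    have h := V.integrable_pow_mul volume m
    refine (integrable_norm_iff (by fun_prop)).1 (h.congr (ae_of_all _ fun s => ?_))
    simp
  rw [SchwartzMap.fourier_coe, Real.iteratedDeriv_fourier hi le_top, Real.fourier_real_eq]
  refine integral_congr_ae (ae_of_all _ fun s => ?_)
  simp only [Circle.smul_def, Real.fourierChar_apply, smul_eq_mul, modulation]
  congr 2
  push_cast
  ring

/-- The pairing of a tempered distribution with `W ĥ` as an integral over frequencies. -/
theorem ContinuousLinearMap.apply_smulLeftCLM_angularFourier (T : 𝓢(ℝ, ℂ) →L[ℂ] ℂ)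
    (W h : 𝓢(ℝ, ℂ)) (hs : HasCompactSupport h) :
    T (SchwartzMap.smulLeftCLM ℂ (angularFourier h) W) =
      ∫ ω, h ω * T (SchwartzMap.smulLeftCLM ℂ (modulation ω) W) := by
  -- On the Fourier side derivatives are integrals with polynomial weights, so the required identity
  -- for all derivatives is a single use of Fubini.
  have hT : ∀ χ : 𝓢(ℝ, ℂ), T χ = (T.comp (FourierTransform.fourierInvCLM ℂ 𝓢(ℝ, ℂ))) (𝓕 χ) := by
    intro χ
    change T χ = T (𝓕⁻ (𝓕 χ))
    rw [FourierTransform.fourierInv_fourier_eq]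
  have hc : Continuous fun ω => 𝓕 (SchwartzMap.smulLeftCLM ℂ (modulation ω) W) :=
    (FourierTransform.fourierCLM ℂ 𝓢(ℝ, ℂ)).continuous.comp (continuous_smulLeftCLM_modulation W)
  rw [hT, ContinuousLinearMap.apply_eq_integral_of_iteratedDeriv _ hc h.continuous hs]
  · simp only [← hT]
  intro n x
  simp only [iteratedDeriv_fourier_apply,
    SchwartzMap.smulLeftCLM_apply_apply (hasTemperateGrowth_modulation _),
    SchwartzMap.smulLeftCLM_apply_apply (angularFourier h).hasTemperateGrowth,
    angularFourier_apply, smul_eq_mul]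
  have hi : Integrable (fun z : ℝ × ℝ => modulation (2 * Real.pi * x) z.1 *
      ((-2 * Real.pi * Complex.I * z.1) ^ n * (modulation z.2 z.1 * h z.2 * W z.1)))
      (volume.prod volume) := by
    have h1 : Integrable fun s : ℝ => (-2 * Real.pi * Complex.I * s : ℂ) ^ n * W s := by
      have h := (W.integrable_pow_mul volume n).const_mul ((2 * Real.pi) ^ n)
      refine (integrable_norm_iff (Continuous.aestronglyMeasurable (by fun_prop))).1
        (h.congr (ae_of_all _ fun s => ?_))
      simp [mul_pow, abs_of_pos Real.pi_pos]
      ring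
    have h2 := h1.mul_prod (h.integrable (μ := volume))
    have h3 : Continuous fun z : ℝ × ℝ => modulation (2 * Real.pi * x) z.1 * modulation z.2 z.1 := by
      unfold modulation
      fun_prop
    refine (h2.bdd_mul (c := 1) h3.aestronglyMeasurable (ae_of_all _ fun z => ?_)).congr
      (ae_of_all _ fun z => ?_)
    · rw [norm_mul, norm_modulation, norm_modulation, one_mul]
    · ring
  calc _ = ∫ s : ℝ, ∫ ω : ℝ, modulation (2 * Real.pi * x) s *
        ((-2 * Real.pi * Complex.I * s) ^ n * (modulation ω s * h ω * W s)) := by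
        refine integral_congr_ae (ae_of_all _ fun s => ?_)
        simp only [integral_const_mul, integral_mul_const]
        rfl
    _ = ∫ ω : ℝ, ∫ s : ℝ, modulation (2 * Real.pi * x) s *
        ((-2 * Real.pi * Complex.I * s) ^ n * (modulation ω s * h ω * W s)) :=
        integral_integral_swap hi
    _ = _ := by
        refine integral_congr_ae (ae_of_all _ fun ω => ?_)
        simp only [← integral_const_mul]
        refine integral_congr_ae (ae_of_all _ fun s => ?_)
        simp only
        ring

end Modulation

/-! ### The restriction as a limit of functions of positive type -/

section Restriction

theorem mollifier_compSubConstCLM (φ : 𝓢(Spacetime, ℂ)) (ε : ℝ) (z a : Spacetime) :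
    (mollifier φ ε z).compSubConstCLM ℂ a = mollifier φ ε (z + a) := by
  by_cases hε : ε = 0
  · simp [mollifier, hε]
  · ext y
    rw [SchwartzMap.compSubConstCLM_apply, mollifier_apply φ hε, mollifier_apply φ hε, sub_sub,
      add_comm a z]

theorem schwartzConj_mollifier {φ : 𝓢(Spacetime, ℂ)} (hφ : ∀ y, 0 ≤ φ y) (ε : ℝ) (z : Spacetime) :
    schwartzConj (mollifier φ ε z) = mollifier φ ε z := by
  by_cases hε : ε = 0
  · ext y
    simp [schwartzConj_apply, mollifier, hε]
  · ext y
    rw [schwartzConj_apply, mollifier_apply φ hε, map_mul, Complex.conj_ofReal,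
      Complex.conj_eq_iff_im.2 (Complex.nonneg_iff.1 (hφ _)).2.symm]

theorem continuous_mollifier (φ : 𝓢(Spacetime, ℂ)) (ε : ℝ) : Continuous (mollifier φ ε) := by
  have h : mollifier φ ε = fun z => (mollifier φ ε 0).compSubConstCLM ℂ z := by
    funext z
    rw [mollifier_compSubConstCLM, zero_add]
  rw [h]
  exact continuous_compSubConstCLM _

theorem exists_unit_bump : ∃ φ : 𝓢(Spacetime, ℂ),
    HasCompactSupport φ ∧ (∀ y, 0 ≤ φ y) ∧ ∫ y, φ y = 1 := by
  let φ : ContDiffBump (0 : Spacetime) := ⟨1, 2, one_pos, one_lt_two⟩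
  have h1 : ContDiff ℝ (⊤ : ℕ∞) fun x => ((φ.normed volume x : ℝ) : ℂ) :=
    Complex.ofRealCLM.contDiff.comp φ.contDiff_normed
  have h2 : HasCompactSupport fun x => ((φ.normed volume x : ℝ) : ℂ) :=
    φ.hasCompactSupport_normed.comp_left (g := Complex.ofReal) Complex.ofReal_zero
  have h3 : ⇑(h2.toSchwartzMap h1) = fun x => ((φ.normed volume x : ℝ) : ℂ) :=
    funext (h2.toSchwartzMap_toFun h1)
  refine ⟨h2.toSchwartzMap h1, ?_, ?_, ?_⟩
  · rw [h3]
    exact h2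
  · intro y
    rw [h3]
    exact Complex.zero_le_real.2 (φ.nonneg_normed y)
  · rw [h3, integral_complex_ofReal, φ.integral_normed, Complex.ofReal_one]

variable {ι : Type*}

/-- A matrix of tempered distributions that is a limit of continuous functions of positive type. -/
def IsPosDefLimit [Fintype ι] (g : ι → ι → 𝓢'(ℝ, ℂ)) : Prop :=
  ∃ k : ℝ → ι → ι → ℝ → ℂ, (∀ ε, IsPosDefMatrixFun (k ε)) ∧ (∀ ε α β, Continuous (k ε α β)) ∧
    ∀ (α β : ι) (ψ : 𝓢(ℝ, ℂ)),
      Tendsto (fun ε => ∫ s : ℝ, ψ s * k ε α β s) (𝓝[>] 0) (𝓝 (g α β ψ))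

/-- Translating both mollifiers by `s_i n` leaves a function of `s_j - s_i`; since `φ` is real,
conjugation acts only on the coefficients. -/
theorem sum_apply_schwartzConj_mollifier (G : TwoPointMatrix ι) {x n : Spacetime}
    (hstat : StationaryAlong G n) {φ : 𝓢(Spacetime, ℂ)} (hφ : ∀ y, 0 ≤ φ y) (ε : ℝ) {m : ℕ}
    (s : Fin m → ℝ) (v : Fin m → ι → ℂ) (α β : ι) :
    G α β (schwartzConj (∑ i, v i α • mollifier φ ε (x - s i • n)))
        (∑ j, v j β • mollifier φ ε (x - s j • n)) =
      ∑ i, ∑ j, conj (v i α) * v j β *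
        G α β (mollifier φ ε x) (mollifier φ ε (x - (s j - s i) • n)) := by
  have h1 : schwartzConj (∑ i, v i α • mollifier φ ε (x - s i • n)) =
      ∑ i, conj (v i α) • mollifier φ ε (x - s i • n) := by
    conv_rhs => rw [Finset.sum_congr rfl fun i _ => by rw [← schwartzConj_mollifier hφ]]
    ext y
    simp only [schwartzConj_apply, sum_apply, smul_apply, smul_eq_mul,
      map_sum, map_mul]
  have h2 : ∀ i j, G α β (mollifier φ ε (x - s i • n)) (mollifier φ ε (x - s j • n)) =
      G α β (mollifier φ ε x) (mollifier φ ε (x - (s j - s i) • n)) := by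
    intro i j
    have h : x - s j • n + s i • n = x - (s j - s i) • n := by module
    rw [← hstat α β (s i), mollifier_compSubConstCLM, mollifier_compSubConstCLM, sub_add_cancel, h]
  rw [h1, map_sum (G α β)]
  have h3 : ∀ (T : Fin m → 𝓢'(Spacetime, ℂ)) (f : 𝓢(Spacetime, ℂ)), (∑ i, T i) f = ∑ i, T i f :=
    fun T f => sum_apply _ _ _
  rw [h3]
  refine Finset.sum_congr rfl fun i _ => ?_
  rw [map_sum]
  refine Finset.sum_congr rfl fun j _ => ?_
  rw [map_smul, map_smul, smul_eq_mul, ← h2]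
  have h4 : ∀ (c : ℂ) (T : 𝓢'(Spacetime, ℂ)) (f : 𝓢(Spacetime, ℂ)), (c • T) f = c * T f :=
    fun _ _ _ => rfl
  rw [h4]
  ring

theorem isPosDefLimit_of_isRestrictionAlong [Fintype ι] {G : TwoPointMatrix ι} (hG : WightmanPositive G)
    {x n : Spacetime} (hstat : StationaryAlong G n) {g : ι → ι → 𝓢'(ℝ, ℂ)}
    (hg : IsRestrictionAlong G x n g) : IsPosDefLimit g := by
  obtain ⟨φ, hφc, hφ, hφ1⟩ := exists_unit_bump
  refine ⟨fun ε α β u => G α β (mollifier φ ε x) (mollifier φ ε (x - u • n)), fun ε m s v => ?_,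
    fun ε α β => ?_, fun α β ψ => hg φ hφc hφ hφ1 α β ψ⟩
  · have h := hG fun α => ∑ i, v i α • mollifier φ ε (x - s i • n)
    simp only [sum_apply_schwartzConj_mollifier G hstat hφ] at h
    convert h using 1
    simp only [Finset.sum_comm (s := (Finset.univ : Finset (Fin m))) (t := (Finset.univ : Finset ι))]
  · exact (G α β (mollifier φ ε x)).continuous.comp
      ((continuous_mollifier φ ε).comp (by fun_prop))

end Restriction

/-! ### Positivity of products and of the Fourier transform -/

section PosDefLimit

variable {ι : Type*} [Fintype ι]

theorem IsPosDefMatrixFun.scale {h : ι → ι → ℝ → ℂ} (hh : IsPosDefMatrixFun h) (F : ι → ℂ) :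
    IsPosDefMatrixFun fun α β u => F α * conj (F β) * h α β u := by
  intro m s v
  refine (hh m s fun i α => conj (F α) * v i α).trans_eq (Finset.sum_congr rfl fun i _ =>
    Finset.sum_congr rfl fun j _ => Finset.sum_congr rfl fun α _ =>
      Finset.sum_congr rfl fun β _ => ?_)
  rw [map_mul, Complex.conj_conj]
  ring

theorem IsPosDefLimit.isPositiveType {g : ι → ι → 𝓢'(ℝ, ℂ)} (hg : IsPosDefLimit g) :
    IsPositiveType g := by
  obtain ⟨k, hk, hc, ht⟩ := hg
  intro ψ
  exact ge_of_tendsto' (tendsto_finsetSum _ fun α _ => tendsto_finsetSum _ fun β _ =>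
    ht α β (correlation (ψ α) (ψ β))) fun ε => (hk ε).integral_correlation_nonneg (hc ε) ψ

theorem Function.HasTemperateGrowth.complexOfReal {w : ℝ → ℝ} (hw : w.HasTemperateGrowth) :
    Function.HasTemperateGrowth fun s => (w s : ℂ) :=
  Function.Complex.hasTemperateGrowth_ofReal.comp hw

theorem IsPosDefLimit.kernelMul {g : ι → ι → 𝓢'(ℝ, ℂ)} (hg : IsPosDefLimit g) {w : ℝ → ℝ}
    (hw : w.HasTemperateGrowth) (hp : IsPositiveTypeFun w) : IsPosDefLimit (kernelMul w g) := by
  obtain ⟨k, hk, hc, ht⟩ := hg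
  refine ⟨fun ε α β u => w u * k ε α β u, fun ε => (hk ε).mul hp.isPosDefFun, fun ε α β =>
    hw.complexOfReal.1.continuous.mul (hc ε α β), fun α β ψ => ?_⟩
  have h := ht α β (SchwartzMap.smulLeftCLM ℂ (fun s => (w s : ℂ)) ψ)
  simp only [SchwartzMap.smulLeftCLM_apply_apply hw.complexOfReal, smul_eq_mul] at h
  simp only [_root_.kernelMul, TemperedDistribution.smulLeftCLM_apply_apply]
  exact h.congr fun ε => integral_congr_ae (ae_of_all _ fun s => by ring)

theorem IsPosDefLimit.smearedCorrelator {g : ι → ι → 𝓢'(ℝ, ℂ)} (hg : IsPosDefLimit g)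
    (F : ι → ℂ) {w : ℝ → ℝ} (hw : w.HasTemperateGrowth) (hp : IsPositiveTypeFun w) :
    IsPosDefLimit (smearedCorrelator F w g) := by
  obtain ⟨k, hk, hc, ht⟩ := hg.kernelMul hw hp
  refine ⟨fun ε α β u => F α * conj (F β) * k ε α β u, fun ε => (hk ε).scale F,
    fun ε α β => continuous_const.mul (hc ε α β), fun α β ψ => ?_⟩
  refine ((ht α β ψ).const_mul (F α * conj (F β))).congr fun ε => ?_
  rw [← integral_const_mul]
  exact integral_congr_ae (ae_of_all _ fun s => by ring)

/-- Before the limit, the form at `x` is the integral of the transform of `h` times `k_ε` contracted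
with `x`: a product of functions of positive type, integrable because `k_ε` is bounded. -/
theorem IsPosDefLimit.posSemidef_kossakowskiDistribution {C : ι → ι → 𝓢'(ℝ, ℂ)}
    (hC : IsPosDefLimit C) {h : 𝓢(ℝ, ℂ)} (hh : ∀ ω, 0 ≤ h ω) :
    (Matrix.of fun α β => kossakowskiDistribution C α β h).PosSemidef := by
  obtain ⟨k, hk, hc, ht⟩ := hC
  refine posSemidef_of_sum_nonneg fun x => ?_
  refine ge_of_tendsto' (tendsto_finsetSum _ fun α _ => tendsto_finsetSum _ fun β _ =>
    (ht α β (angularFourier h)).const_mul (conj (x α) * x β)) fun ε => ?_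
  obtain ⟨M, -, hM⟩ := (hk ε).exists_bound
  have hi : ∀ α β, Integrable fun u =>
      conj (x α) * x β * (angularFourier h u * k ε α β u) := fun α β =>
    ((angularFourier h).integrable.mul_bdd (hc ε α β).aestronglyMeasurable
      (ae_of_all _ (hM α β))).const_mul _
  simp only [← integral_const_mul]
  simp only [← integral_finsetSum _ fun β _ => hi _ β]
  rw [← integral_finsetSum _ fun α _ => integrable_finsetSum _ fun β _ => hi α β]
  exact (((hk ε).mul (isPosDefFun_angularFourier hh)).contract x).integral_nonneg
    (continuous_finsetSum _ fun α _ => continuous_finsetSum _ fun β _ =>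
      continuous_const.mul ((angularFourier h).continuous.mul (hc ε α β)))
    (integrable_finsetSum _ fun α _ => integrable_finsetSum _ fun β _ => hi α β)

end PosDefLimit

/-! ### Continuous densities -/

section Density

variable {ι : Type*}

theorem isContinuousDensity_kossakowskiMatrix (F : ι → ℂ) {w : ℝ → ℝ} (hw : w.HasTemperateGrowth)
    (g : ι → ι → 𝓢'(ℝ, ℂ)) {W : 𝓢(ℝ, ℂ)} (hW : ∀ s, W s = w s) :
    IsContinuousDensity (kossakowskiDistribution (smearedCorrelator F w g))
      (kossakowskiMatrix F W g) := by
  intro α β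
  let T : 𝓢(ℝ, ℂ) →L[ℂ] ℂ := g α β
  have hk : ∀ ω, kossakowskiMatrix F W g ω α β =
      F α * conj (F β) * T (SchwartzMap.smulLeftCLM ℂ (modulation ω) W) := fun _ => rfl
  simp only [hk]
  refine ⟨continuous_const.mul (T.continuous.comp (continuous_smulLeftCLM_modulation W)),
    fun h hs => ?_⟩
  -- The roles of multiplier and test function are exchanged, so that `W` is the fixed test function
  -- and the transform of `h` can be resolved into characters.
  have h1 : SchwartzMap.smulLeftCLM ℂ (fun s => (w s : ℂ)) (angularFourier h) =
      SchwartzMap.smulLeftCLM ℂ (angularFourier h) W := by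
    ext s
    rw [SchwartzMap.smulLeftCLM_apply_apply hw.complexOfReal,
      SchwartzMap.smulLeftCLM_apply_apply (angularFourier h).hasTemperateGrowth, hW, smul_eq_mul,
      smul_eq_mul, mul_comm]
  have h2 : kossakowskiDistribution (smearedCorrelator F w g) α β h = F α * conj (F β) *
      T (SchwartzMap.smulLeftCLM ℂ (fun s => (w s : ℂ)) (angularFourier h)) := rfl
  rw [h2, h1, T.apply_smulLeftCLM_angularFourier W h hs, ← integral_const_mul]
  exact integral_congr_ae (ae_of_all _ fun ω => by ring)

variable [Fintype ι]

theorem IsContinuousDensity.posSemidef {κ : ι → ι → 𝓢'(ℝ, ℂ)} {k : ℝ → Matrix ι ι ℂ}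
    (hk : IsContinuousDensity κ k)
    (hκ : ∀ h : 𝓢(ℝ, ℂ), (∀ ω, 0 ≤ h ω) → (Matrix.of fun α β => κ α β h).PosSemidef) (ω : ℝ) :
    (k ω).PosSemidef := by
  refine posSemidef_of_sum_nonneg fun x => ?_
  let q : ℝ → ℂ := fun t => ∑ α, ∑ β, conj (x α) * x β * k t α β
  have hq : Continuous q := continuous_finsetSum _ fun α _ => continuous_finsetSum _ fun β _ =>
    continuous_const.mul (hk α β).1
  let φ : ℕ → ContDiffBump (0 : ℝ) := fun n =>
    ⟨1 / (n + 1), 2 / (n + 1), by positivity, by gcongr; norm_num⟩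
  have hφ : Tendsto (fun n => (φ n).rOut) atTop (𝓝 0) := by
    have := (tendsto_one_div_add_atTop_nhds_zero_nat (𝕜 := ℝ)).const_mul 2
    rw [mul_zero] at this
    exact this.congr fun n => by simp only [φ]; ring
  have ht := ContDiffBump.convolution_tendsto_right_of_continuous (μ := volume) hφ hq ω
  refine ge_of_tendsto' ht fun n => ?_
  -- With this reflected bump, testing `κ` on `f` is the convolution of the density with the bump at
  -- `ω`.
  let f : ℝ → ℂ := fun t => (((φ n).normed volume (ω - t) : ℝ) : ℂ)
  have h1 : ContDiff ℝ (⊤ : ℕ∞) f :=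
    Complex.ofRealCLM.contDiff.comp ((φ n).contDiff_normed.comp (contDiff_const.sub contDiff_id))
  have h2 : HasCompactSupport f :=
    ((φ n).hasCompactSupport_normed.comp_homeomorph (Homeomorph.subLeft ω)).comp_left
      (g := Complex.ofReal) Complex.ofReal_zero
  have h3 : ⇑(h2.toSchwartzMap h1) = f := funext (h2.toSchwartzMap_toFun h1)
  have h4 := (hκ (h2.toSchwartzMap h1) fun t => by
    rw [h3]
    exact Complex.zero_le_real.2 ((φ n).nonneg_normed _)).sum_nonneg x
  have hi : ∀ α β, Integrable fun t => conj (x α) * x β * (k t α β * f t) := fun α β =>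
    (((hk α β).1.mul h1.continuous).integrable_of_hasCompactSupport h2.mul_left).const_mul _
  convert h4 using 1
  have h5 : ∀ α β, κ α β (h2.toSchwartzMap h1) = ∫ t, k t α β * f t := fun α β => by
    rw [(hk α β).2 _ (by rw [h3]; exact h2), h3]
  simp only [Matrix.of_apply, h5, ← integral_const_mul]
  simp only [← integral_finsetSum _ fun β _ => hi _ β]
  rw [← integral_finsetSum _ fun α _ => integrable_finsetSum _ fun β _ => hi α β,
    convolution_eq_swap]
  refine integral_congr_ae (ae_of_all _ fun t => ?_)
  simp only [q, f, ContinuousLinearMap.lsmul_apply, Complex.real_smul, Finset.mul_sum]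
  exact Finset.sum_congr rfl fun α _ => Finset.sum_congr rfl fun β _ => by ring

end Density

end

/-! ### Assembly of the theorem -/

theorem mainTheorem1 {ι : Type*} [Fintype ι]
    (G : TwoPointMatrix ι) (hG : WightmanPositive G)
    (C : Spacetime → ℝ) (hC : IsClockField C) (τ : ℝ) (x : Spacetime)
    (hx : x ∈ clockHypersurface C τ)
    (hstat : StationaryAlong G (clockNormal C x))
    (g : ι → ι → 𝓢'(ℝ, ℂ)) (hg : IsRestrictionAlong G x (clockNormal C x) g)
    (F : ι → Spacetime → ℂ)
    {H : Type*} [NormedAddCommGroup H] [InnerProductSpace ℂ H] [CompleteSpace H]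
    (HS : Spacetime → (H →L[ℂ] H)) (hHS : ∀ y, IsSelfAdjoint (HS y))
    (HLS : Set Spacetime → Spacetime → (H →L[ℂ] H)) (hHLS : ∀ T y, IsSelfAdjoint (HLS T y))
    (A : ι → ℝ → Spacetime → (H →L[ℂ] H)) (S : Set ℝ) :
    IsPositiveType g ∧
    ∀ w : ℝ → ℝ, Function.HasTemperateGrowth w → IsPositiveTypeFun w →
      IsPositiveType (kernelMul w g) ∧
      IsPositiveType (smearedCorrelator (fun α => F α x) w g) ∧
      (∀ h : 𝓢(ℝ, ℂ), (∀ ω, 0 ≤ h ω) →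
        (Matrix.of fun α β => kossakowskiDistribution
          (smearedCorrelator (fun α => F α x) w g) α β h).PosSemidef) ∧
      (∀ W : 𝓢(ℝ, ℂ), (∀ s, W s = w s) →
        IsContinuousDensity
          (kossakowskiDistribution (smearedCorrelator (fun α => F α x) w g))
          (kossakowskiMatrix (fun α => F α x) W g)) ∧
      ∀ k : ℝ → Matrix ι ι ℂ,
        IsContinuousDensity
          (kossakowskiDistribution (smearedCorrelator (fun α => F α x) w g)) k →
        (∀ ω, (k ω).PosSemidef) ∧
        ((∀ α β, Summable fun ω : S => ‖k ω α β‖ * ‖A α ω x‖ * ‖A β ω x‖) →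
          IsCPTPGenerator
            (gklsGenerator (HS x + HLS (clockHypersurface C τ) x) S k (fun α ω => A α ω x))) := by
  have hL := isPosDefLimit_of_isRestrictionAlong hG hstat hg
  refine ⟨hL.isPositiveType, fun w hw hp => ?_⟩
  have hC := hL.smearedCorrelator (fun α => F α x) hw hp
  refine ⟨(hL.kernelMul hw hp).isPositiveType, hC.isPositiveType,
    fun h hh => hC.posSemidef_kossakowskiDistribution hh,
    fun W hW => isContinuousDensity_kossakowskiMatrix _ hw g hW, fun k hk => ?_⟩
  have hpos : ∀ ω, (k ω).PosSemidef :=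
    hk.posSemidef fun h hh => hC.posSemidef_kossakowskiDistribution hh
  exact ⟨hpos, fun hS => isCPTPGenerator_gklsGenerator ((hHS x).add (hHLS _ x)) hpos hS⟩
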